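/- **Setting (LFR: canonical LF with refinement types).** All syntax is taken up to renaming of bound variables. The grammar is atomic terms $R ::= c \mid x \mid R\,N$; normal terms $N ::= R \mid \lambda x.N$; atomic types $P ::= a \mid P\,N$; types $A ::= P \mid \Pi x{:}A_1.A_2$; kinds $K ::= \mathsf{type} \mid \Pi x{:}A.K$; atomic sorts $Q ::= s \mid Q\,N$; sorts $S ::= Q \mid \Pi x{::}S_1{\sqsubset}A_1.S_2 \mid \top \mid S_1\wedge S_2$; classes $L ::= \mathsf{sort} \mid \Pi x{::}S{\sqsubset}A.L \mid \top \mid L_1\wedge L_2$. A signature $\Sigma$ is a finite list of declarations $a:K$, $c:A$, $s\sqsubset a::L$, $s_1\le s_2$, $c::S$; a context $\Gamma$ is a finite list of declarations $x::S\sqsubset A$ of distinct variables. $\Sigma^*$ keeps the declarations $a:K$ and $c:A$ of $\Sigma$, and $\Gamma^*$ replaces each $x::S\sqsubset A$ by $x:A$. Simple types are $\alpha ::= a \mid \alpha_1\to\alpha_2$, with $|a\,N_1\cdots N_n|=a$ and $|\Pi x{:}A.B|=|A|\to|B|$. *Hereditary substitution* is the family of relations generated as follows (bound variables are renamed to avoid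 capture). Into atomic terms with head other than $x_0$: $[N_0/x_0]^{rr}_{\alpha_0}x=x$ for $x\ne x_0$, $[N_0/x_0]^{rr}_{\alpha_0}c=c$, and $[N_0/x_0]^{rr}_{\alpha_0}(R_1N_2)=R_1'N_2'$ if $[N_0/x_0]^{rr}_{\alpha_0}R_1=R_1'$ and $[N_0/x_0]^n_{\alpha_0}N_2=N_2'$. Into atomic terms with head $x_0$: $[N_0/x_0]^{rn}_{\alpha_0}x_0=(N_0,\alpha_0)$, and $[N_0/x_0]^{rn}_{\alpha_0}(R_1N_2)=(N_1',\alpha_1)$ if $[N_0/x_0]^{rn}_{\alpha_0}R_1=(\lambda x.N_1,\alpha_2\to\alpha_1)$, $[N_0/x_0]^n_{\alpha_0}N_2=N_2'$ and $[N_2'/x]^n_{\alpha_2}N_1=N_1'$. Into normal terms: $[N_0/x_0]^n_{\alpha_0}R=R'$ if $[N_0/x_0]^{rr}_{\alpha_0}R=R'$ or $[N_0/x_0]^{rn}_{\alpha_0}R=(R',a)$ with $R'$ atomic and $a$ a base type, and $[N_0/x_0]^n_{\alpha_0}\lambda x.N=\lambda x.N'$ if $[N_0/x_0]^n_{\alpha_0}N=N'$.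 On all other categories (atomic types and types, atomic sorts and sorts, kinds, classes, contexts) it is compositional. The index $A_0$ stands for $|A_0|$. *Canonical LF* (over $\Sigma^*$ and contexts of declarations $x:A$). $c\Rightarrow A$ if $c:A\in\Sigma^*$; $x\Rightarrow A$ if $x:A\in\Gamma$; $R\,N\Rightarrow[N/x]_{A}B$ (if defined) when $R\Rightarrow\Pi x{:}A.B$ and $N\Leftarrow A$; $R\Leftarrow P$ if $R\Rightarrow P$; $\lambda x.N\Leftarrow\Pi x{:}A.B$ if $\Gamma,x{:}A\vdash N\Leftarrow B$. Likewise $a\Rightarrow K$ if $a:K\in\Sigma^*$, and $P\,N\Rightarrow[N/x]_AK$ (if defined) when $P\Rightarrow\Pi x{:}A.K$ and $N\Leftarrow A$; $P\Leftarrow\mathsf{type}$ if $P\Rightarrow\mathsf{type}$; $\Pi x{:}A.B\Leftarrow\mathsf{type}$ if $A\Leftarrow\mathsf{type}$ and $\Gamma,x{:}A\vdash B\Leftarrow\mathsf{type}$; $\mathsf{type}\Leftarrow\mathsf{kind}$, and $\Pi x{:}A.K\Leftarrow\mathsf{kind}$ if $A\Leftarrow\mathsf{type}$ and $\Gamma,x{:}A\vdash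 K\Leftarrow\mathsf{kind}$. An LF context is well-formed if each type in it is a well-formed type in the context before it. *Refinements* (over $\Sigma$). Subsorting $\le$ on atomic sorts is the reflexive-transitive closure of $s_1N_1\cdots N_n\le s_2N_1\cdots N_n$ for $s_1\le s_2\in\Sigma$. Sort synthesis: $c\Rightarrow S$ if $c::S\in\Sigma$; $x\Rightarrow S$ if $x::S\sqsubset A\in\Gamma$; $R\,N\Rightarrow[N/x]_AT$ (if defined) when $R\Rightarrow\Pi x{::}S{\sqsubset}A.T$ and $N\Leftarrow S$; $R\Rightarrow S_i$ if $R\Rightarrow S_1\wedge S_2$. Sort checking: $R\Leftarrow Q$ if $R\Rightarrow Q'$ and $Q'\le Q$; $\lambda x.N\Leftarrow\Pi x{::}S{\sqsubset}A.T$ if $\Gamma,x{::}S{\sqsubset}A\vdash N\Leftarrow T$; always $N\Leftarrow\top$; $N\Leftarrow S_1\wedge S_2$ if $N\Leftarrow S_1$ and $N\Leftarrow S_2$. Class synthesis: $s\sqsubset a\Rightarrow L$ if $s\sqsubset a::L\in\Sigma$; $Q\,N\sqsubset P\,N\Rightarrow[N/x]_AL$ (if defined) when $Q\sqsubset P\Rightarrow\Pi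 x{::}S{\sqsubset}A.L$ and $N\Leftarrow S$; $Q\sqsubset P\Rightarrow L_i$ if $Q\sqsubset P\Rightarrow L_1\wedge L_2$. Sort formation: $Q\sqsubset P$ if $Q\sqsubset P\Rightarrow\mathsf{sort}$; $\Pi x{::}S{\sqsubset}A.S'\sqsubset\Pi x{:}A.A'$ if $S\sqsubset A$ and $\Gamma,x{::}S{\sqsubset}A\vdash S'\sqsubset A'$; always $\top\sqsubset A$; $S_1\wedge S_2\sqsubset A$ if $S_1\sqsubset A$ and $S_2\sqsubset A$. Class formation $L\sqsubset K$ is analogous: $\mathsf{sort}\sqsubset\mathsf{type}$, $\Pi x{::}S{\sqsubset}A.L\sqsubset\Pi x{:}A.K$ if $S\sqsubset A$ and $\Gamma,x{::}S{\sqsubset}A\vdash L\sqsubset K$, $\top\sqsubset K$, and $L_1\wedge L_2\sqsubset K$ if $L_1\sqsubset K$ and $L_2\sqsubset K$. A context is well-formed ($\vdash\Gamma\ \mathsf{ctx}$) if for each $x::S\sqsubset A$ in it $S\sqsubset A$ holds in the context before it. $\Sigma$ is well-formed if each declaration is well-formed in the signature before it and the empty context: for $a:K$, $K\Leftarrow\mathsf{kind}$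 (in LF) and $a$ has no earlier kind declaration; for $c:A$, $A\Leftarrow\mathsf{type}$ (in LF) and $c$ has no earlier type declaration; for $s\sqsubset a::L$, some $a:K$ is declared with $L\sqsubset K$, and $s$ is not yet declared; for $c::S$, some $c:A$ is declared with $S\sqsubset A$, and $c$ has no earlier sort declaration; for $s_1\le s_2$, both $s_1\sqsubset a::L$ and $s_2\sqsubset a::L$ are declared for some $a$, $L$. **Theorem (Substitution).** Let $\Sigma$ be a well-formed signature. Write $\Gamma=\Gamma_L,\,x_0{::}S_0{\sqsubset}A_0,\,\Gamma_R$ and suppose $\Gamma_L\vdash N_0\Leftarrow S_0$ and $\Gamma_L^*\vdash N_0\Leftarrow A_0$, and $\vdash\Gamma\ \mathsf{ctx}$ and $\Gamma^*$ is a well-formed LF context. Then there is $\Gamma_R'$ with $[N_0/x_0]_{A_0}\Gamma_R=\Gamma_R'$ such that $\vdash\Gamma'\ \mathsf{ctx}$ and $\Gamma'^*$ is a well-formed LF context, where $\Gamma'=\Gamma_L,\Gamma_R'$, and moreover: 1. (Normal terms) If $\Gamma\vdash S\sqsubset A$ and $\Gamma^*\vdash A\Leftarrow\mathsf{type}$,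 and $\Gamma\vdash N\Leftarrow S$ and $\Gamma^*\vdash N\Leftarrow A$, then there are $S',A',N'$ with $[N_0/x_0]_{A_0}S=S'$, $[N_0/x_0]_{A_0}A=A'$, $[N_0/x_0]^n_{A_0}N=N'$, and $\Gamma'\vdash S'\sqsubset A'$, $\Gamma'^*\vdash A'\Leftarrow\mathsf{type}$, $\Gamma'\vdash N'\Leftarrow S'$, $\Gamma'^*\vdash N'\Leftarrow A'$. 2. (Atomic terms) If $\Gamma\vdash R\Rightarrow S$ and $\Gamma^*\vdash R\Rightarrow A$, then there are $S',A'$ with $[N_0/x_0]_{A_0}S=S'$ and $[N_0/x_0]_{A_0}A=A'$, and either $[N_0/x_0]^{rr}_{A_0}R=R'$ for some $R'$ with $\Gamma'\vdash R'\Rightarrow S'$ and $\Gamma'^*\vdash R'\Rightarrow A'$, or $[N_0/x_0]^{rn}_{A_0}R=(N',|A'|)$ for some $N'$ with $\Gamma'\vdash N'\Leftarrow S'$ and $\Gamma'^*\vdash N'\Leftarrow A'$. 3. (Sorts and types) If $\Gamma\vdash S\sqsubset A$ and $\Gamma^*\vdash A\Leftarrow\mathsf{type}$, then there are $S',A'$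 with $[N_0/x_0]_{A_0}S=S'$, $[N_0/x_0]_{A_0}A=A'$, $\Gamma'\vdash S'\sqsubset A'$ and $\Gamma'^*\vdash A'\Leftarrow\mathsf{type}$. 4. (Atomic sorts and types) If $\Gamma\vdash Q\sqsubset P\Rightarrow L$ and $\Gamma^*\vdash P\Rightarrow K$, then there are $Q',P',L',K'$ that are the results of $[N_0/x_0]_{A_0}$ on $Q,P,L,K$, and $\Gamma'\vdash Q'\sqsubset P'\Rightarrow L'$ and $\Gamma'^*\vdash P'\Rightarrow K'$. 5. (Classes and kinds) If $\Gamma\vdash L\sqsubset K$ and $\Gamma^*\vdash K\Leftarrow\mathsf{kind}$, then there are $L',K'$ with $[N_0/x_0]_{A_0}L=L'$, $[N_0/x_0]_{A_0}K=K'$, $\Gamma'\vdash L'\sqsubset K'$ and $\Gamma'^*\vdash K'\Leftarrow\mathsf{kind}$. -/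

import Mathlib

/-!
LF with refinement types (LFR), in canonical form, together with the underlying canonical LF.

Terms are taken up to renaming of bound variables by means of de Bruijn indices: index `0` is the
innermost binder (or the last declaration of the context).  Contexts are lists whose head is the
*last* declaration, so the context `Γ_L, x₀::S₀⊏A₀, Γ_R` is `ΓR ++ (S₀, A₀) :: ΓL`, and in it the
variable `x₀` has index `ΓR.length`.
-/

namespace LFR

/-! ### Grammar -/

/-- Names of type family constants `a`. -/
abbrev TyConst := ℕ

/-- Names of term constants `c`. -/
abbrev TmConst := ℕ

/-- Names of sort family constants `s`. -/
abbrev SrtConst := ℕ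

mutual
  /-- Atomic terms `R ::= c | x | R N`. -/
  inductive Atm : Type where
    | const (c : TmConst) : Atm
    | var (i : ℕ) : Atm
    | app (R : Atm) (N : Nrm) : Atm
  /-- Normal terms `N ::= R | λx. N`. -/
  inductive Nrm : Type where
    | atm (R : Atm) : Nrm
    | lam (N : Nrm) : Nrm
end

/-- Atomic type families `P ::= a | P N`. -/
inductive ATy : Type where
  | const (a : TyConst) : ATy
  | app (P : ATy) (N : Nrm) : ATy

/-- Normal type families `A ::= P | Πx:A₁. A₂`. -/
inductive Ty : Type where
  | atm (P : ATy) : Ty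
  | pi (A₁ A₂ : Ty) : Ty

/-- Kinds `K ::= type | Πx:A. K`. -/
inductive Kind : Type where
  | type : Kind
  | pi (A : Ty) (K : Kind) : Kind

/-- Atomic sort families `Q ::= s | Q N`. -/
inductive ASrt : Type where
  | const (s : SrtConst) : ASrt
  | app (Q : ASrt) (N : Nrm) : ASrt

/-- Normal sort families `S ::= Q | Πx::S₁⊏A₁. S₂ | ⊤ | S₁ ∧ S₂`. -/
inductive Srt : Type where
  | atm (Q : ASrt) : Srt
  | pi (S₁ : Srt) (A₁ : Ty) (S₂ : Srt) : Srt
  | top : Srt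
  | inter (S₁ S₂ : Srt) : Srt

/-- Classes `L ::= sort | Πx::S⊏A. L | ⊤ | L₁ ∧ L₂`. -/
inductive Cls : Type where
  | sort : Cls
  | pi (S : Srt) (A : Ty) (L : Cls) : Cls
  | top : Cls
  | inter (L₁ L₂ : Cls) : Cls

/-- Declarations of an LF signature: `a : K` and `c : A`. -/
inductive LFDecl : Type where
  | ty (a : TyConst) (K : Kind) : LFDecl
  | tm (c : TmConst) (A : Ty) : LFDecl

/-- LF signatures; the head of the list is the last declaration. -/
abbrev LFSig := List LFDecl

/-- Declarations of an LFR signature: `a : K`, `c : A`, `s ⊏ a :: L`, `s₁ ≤ s₂` and `c :: S`. -/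
inductive Decl : Type where
  | ty (a : TyConst) (K : Kind) : Decl
  | tm (c : TmConst) (A : Ty) : Decl
  | srt (s : SrtConst) (a : TyConst) (L : Cls) : Decl
  | sub (s₁ s₂ : SrtConst) : Decl
  | tmSrt (c : TmConst) (S : Srt) : Decl

/-- LFR signatures; the head of the list is the last declaration. -/
abbrev Sig := List Decl

/-- LF contexts, declaring `x : A`; the head of the list is the last declaration. -/
abbrev LFCtx := List Ty

/-- LFR contexts, declaring `x :: S ⊏ A`; the head of the list is the last declaration. -/
abbrev Ctx := List (Srt × Ty)

/-- The LF declaration contained in an LFR declaration, if any. -/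
def Decl.erase : Decl → Option LFDecl
  | .ty a K => some (.ty a K)
  | .tm c A => some (.tm c A)
  | .srt _ _ _ => none
  | .sub _ _ => none
  | .tmSrt _ _ => none

/-- The LF signature `Σ*` underlying an LFR signature. -/
def Sig.erase (Sg : Sig) : LFSig := Sg.filterMap Decl.erase

/-- The LF context `Γ*` underlying an LFR context. -/
def Ctx.erase (Γ : Ctx) : LFCtx := Γ.map Prod.snd

/-! ### Renaming and weakening -/

/-- Extension of a renaming under one binder. -/
def upRen (ρ : ℕ → ℕ) : ℕ → ℕ
  | 0 => 0
  | i + 1 => ρ i + 1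

mutual
  def Atm.ren (ρ : ℕ → ℕ) : Atm → Atm
    | .const c => .const c
    | .var i => .var (ρ i)
    | .app R N => .app (R.ren ρ) (N.ren ρ)
  def Nrm.ren (ρ : ℕ → ℕ) : Nrm → Nrm
    | .atm R => .atm (R.ren ρ)
    | .lam N => .lam (N.ren (upRen ρ))
end

def ATy.ren (ρ : ℕ → ℕ) : ATy → ATy
  | .const a => .const a
  | .app P N => .app (P.ren ρ) (N.ren ρ)

def Ty.ren (ρ : ℕ → ℕ) : Ty → Ty
  | .atm P => .atm (P.ren ρ)
  | .pi A₁ A₂ => .pi (A₁.ren ρ) (A₂.ren (upRen ρ))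

def ASrt.ren (ρ : ℕ → ℕ) : ASrt → ASrt
  | .const s => .const s
  | .app Q N => .app (Q.ren ρ) (N.ren ρ)

def Srt.ren (ρ : ℕ → ℕ) : Srt → Srt
  | .atm Q => .atm (Q.ren ρ)
  | .pi S₁ A₁ S₂ => .pi (S₁.ren ρ) (A₁.ren ρ) (S₂.ren (upRen ρ))
  | .top => .top
  | .inter S₁ S₂ => .inter (S₁.ren ρ) (S₂.ren ρ)

/-- Weakening of a normal term by `n` variables. -/
def Nrm.shift (n : ℕ) (N : Nrm) : Nrm := N.ren (· + n)

/-- Weakening of a type by `n` variables. -/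
def Ty.shift (n : ℕ) (A : Ty) : Ty := A.ren (· + n)

/-- Weakening of a sort by `n` variables. -/
def Srt.shift (n : ℕ) (S : Srt) : Srt := S.ren (· + n)

/-! ### Simple types and erasure of dependencies -/

/-- Simple types `α ::= a | α₁ → α₂`. -/
inductive STy : Type where
  | base (a : TyConst) : STy
  | arrow (α₁ α₂ : STy) : STy

/-- The head constant of an atomic type family. -/
def ATy.head : ATy → TyConst
  | .const a => a
  | .app P _ => P.head

/-- The simple type `|A|` underlying the type `A`. -/
def Ty.simple : Ty → STy
  | .atm P => .base P.head
  | .pi A₁ A₂ => .arrow A₁.simple A₂.simple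

/-! ### Hereditary substitution

In `HSubstN N₀ k α₀ N N'` (and similarly for the other categories) the variable `x₀` that is
replaced has index `k` in the subject `N`.  The term `N₀` lives in the context to the left of `x₀`,
so it is weakened by `k` where it is put in place of `x₀`, and the indices of the variables to the
left of `x₀` drop by one. -/

mutual
  /-- `[N₀/x₀]ⁿ_α₀ N = N'`. -/
  inductive HSubstN : Nrm → ℕ → STy → Nrm → Nrm → Prop where
    | atm {N₀ : Nrm} {k : ℕ} {α₀ : STy} {R R' : Atm} :
        HSubstRR N₀ k α₀ R R' → HSubstN N₀ k α₀ (.atm R) (.atm R')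
    | atmNorm {N₀ : Nrm} {k : ℕ} {α₀ : STy} {R R' : Atm} {a : TyConst} :
        HSubstRN N₀ k α₀ R (.atm R') (.base a) → HSubstN N₀ k α₀ (.atm R) (.atm R')
    | lam {N₀ : Nrm} {k : ℕ} {α₀ : STy} {N N' : Nrm} :
        HSubstN N₀ (k + 1) α₀ N N' → HSubstN N₀ k α₀ (.lam N) (.lam N')
  /-- `[N₀/x₀]ʳʳ_α₀ R = R'`: substitution into an atomic term with a head other than `x₀`. -/
  inductive HSubstRR : Nrm → ℕ → STy → Atm → Atm → Prop where
    | varLt {N₀ : Nrm} {k : ℕ} {α₀ : STy} {i : ℕ} :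
        i < k → HSubstRR N₀ k α₀ (.var i) (.var i)
    | varGt {N₀ : Nrm} {k : ℕ} {α₀ : STy} {i : ℕ} :
        k ≤ i → HSubstRR N₀ k α₀ (.var (i + 1)) (.var i)
    | const {N₀ : Nrm} {k : ℕ} {α₀ : STy} {c : TmConst} :
        HSubstRR N₀ k α₀ (.const c) (.const c)
    | app {N₀ : Nrm} {k : ℕ} {α₀ : STy} {R₁ R₁' : Atm} {N₂ N₂' : Nrm} :
        HSubstRR N₀ k α₀ R₁ R₁' → HSubstN N₀ k α₀ N₂ N₂' →
        HSubstRR N₀ k α₀ (.app R₁ N₂) (.app R₁' N₂')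
  /-- `[N₀/x₀]ʳⁿ_α₀ R = (N', α')`: substitution into an atomic term with head `x₀`. -/
  inductive HSubstRN : Nrm → ℕ → STy → Atm → Nrm → STy → Prop where
    | var {N₀ : Nrm} {k : ℕ} {α₀ : STy} :
        HSubstRN N₀ k α₀ (.var k) (N₀.shift k) α₀
    | beta {N₀ : Nrm} {k : ℕ} {α₀ : STy} {R₁ : Atm} {N₁ N₂ N₂' N₁' : Nrm} {α₁ α₂ : STy} :
        HSubstRN N₀ k α₀ R₁ (.lam N₁) (.arrow α₂ α₁) →
        HSubstN N₀ k α₀ N₂ N₂' →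
        HSubstN N₂' 0 α₂ N₁ N₁' →
        HSubstRN N₀ k α₀ (.app R₁ N₂) N₁' α₁
end

/-- `[N₀/x₀]ᵖ_α₀ P = P'`. -/
inductive HSubstP : Nrm → ℕ → STy → ATy → ATy → Prop where
  | const {N₀ : Nrm} {k : ℕ} {α₀ : STy} {a : TyConst} :
      HSubstP N₀ k α₀ (.const a) (.const a)
  | app {N₀ : Nrm} {k : ℕ} {α₀ : STy} {P P' : ATy} {N N' : Nrm} :
      HSubstP N₀ k α₀ P P' → HSubstN N₀ k α₀ N N' → HSubstP N₀ k α₀ (.app P N) (.app P' N')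

/-- `[N₀/x₀]ᵃ_α₀ A = A'`. -/
inductive HSubstA : Nrm → ℕ → STy → Ty → Ty → Prop where
  | atm {N₀ : Nrm} {k : ℕ} {α₀ : STy} {P P' : ATy} :
      HSubstP N₀ k α₀ P P' → HSubstA N₀ k α₀ (.atm P) (.atm P')
  | pi {N₀ : Nrm} {k : ℕ} {α₀ : STy} {A₁ A₁' A₂ A₂' : Ty} :
      HSubstA N₀ k α₀ A₁ A₁' → HSubstA N₀ (k + 1) α₀ A₂ A₂' →
      HSubstA N₀ k α₀ (.pi A₁ A₂) (.pi A₁' A₂')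

/-- `[N₀/x₀]ᵏ_α₀ K = K'`. -/
inductive HSubstK : Nrm → ℕ → STy → Kind → Kind → Prop where
  | type {N₀ : Nrm} {k : ℕ} {α₀ : STy} : HSubstK N₀ k α₀ .type .type
  | pi {N₀ : Nrm} {k : ℕ} {α₀ : STy} {A A' : Ty} {K K' : Kind} :
      HSubstA N₀ k α₀ A A' → HSubstK N₀ (k + 1) α₀ K K' →
      HSubstK N₀ k α₀ (.pi A K) (.pi A' K')

/-- `[N₀/x₀]^q_α₀ Q = Q'`. -/
inductive HSubstQ : Nrm → ℕ → STy → ASrt → ASrt → Prop where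
  | const {N₀ : Nrm} {k : ℕ} {α₀ : STy} {s : SrtConst} :
      HSubstQ N₀ k α₀ (.const s) (.const s)
  | app {N₀ : Nrm} {k : ℕ} {α₀ : STy} {Q Q' : ASrt} {N N' : Nrm} :
      HSubstQ N₀ k α₀ Q Q' → HSubstN N₀ k α₀ N N' → HSubstQ N₀ k α₀ (.app Q N) (.app Q' N')

/-- `[N₀/x₀]ˢ_α₀ S = S'`. -/
inductive HSubstS : Nrm → ℕ → STy → Srt → Srt → Prop where
  | atm {N₀ : Nrm} {k : ℕ} {α₀ : STy} {Q Q' : ASrt} :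
      HSubstQ N₀ k α₀ Q Q' → HSubstS N₀ k α₀ (.atm Q) (.atm Q')
  | pi {N₀ : Nrm} {k : ℕ} {α₀ : STy} {S₁ S₁' : Srt} {A₁ A₁' : Ty} {S₂ S₂' : Srt} :
      HSubstS N₀ k α₀ S₁ S₁' → HSubstA N₀ k α₀ A₁ A₁' → HSubstS N₀ (k + 1) α₀ S₂ S₂' →
      HSubstS N₀ k α₀ (.pi S₁ A₁ S₂) (.pi S₁' A₁' S₂')
  | top {N₀ : Nrm} {k : ℕ} {α₀ : STy} : HSubstS N₀ k α₀ .top .top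
  | inter {N₀ : Nrm} {k : ℕ} {α₀ : STy} {S₁ S₁' S₂ S₂' : Srt} :
      HSubstS N₀ k α₀ S₁ S₁' → HSubstS N₀ k α₀ S₂ S₂' →
      HSubstS N₀ k α₀ (.inter S₁ S₂) (.inter S₁' S₂')

/-- `[N₀/x₀]ˡ_α₀ L = L'`. -/
inductive HSubstL : Nrm → ℕ → STy → Cls → Cls → Prop where
  | sort {N₀ : Nrm} {k : ℕ} {α₀ : STy} : HSubstL N₀ k α₀ .sort .sort
  | pi {N₀ : Nrm} {k : ℕ} {α₀ : STy} {S S' : Srt} {A A' : Ty} {L L' : Cls} :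
      HSubstS N₀ k α₀ S S' → HSubstA N₀ k α₀ A A' → HSubstL N₀ (k + 1) α₀ L L' →
      HSubstL N₀ k α₀ (.pi S A L) (.pi S' A' L')
  | top {N₀ : Nrm} {k : ℕ} {α₀ : STy} : HSubstL N₀ k α₀ .top .top
  | inter {N₀ : Nrm} {k : ℕ} {α₀ : STy} {L₁ L₁' L₂ L₂' : Cls} :
      HSubstL N₀ k α₀ L₁ L₁' → HSubstL N₀ k α₀ L₂ L₂' →
      HSubstL N₀ k α₀ (.inter L₁ L₂) (.inter L₁' L₂')

/-- `[N₀/x₀]^γ_α₀ Γ = Γ'`, where `Γ` is the part of the context to the right of `x₀`. -/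
inductive HSubstCtx : Nrm → STy → Ctx → Ctx → Prop where
  | nil {N₀ : Nrm} {α₀ : STy} : HSubstCtx N₀ α₀ [] []
  | cons {N₀ : Nrm} {α₀ : STy} {Γ Γ' : Ctx} {S S' : Srt} {A A' : Ty} :
      HSubstCtx N₀ α₀ Γ Γ' → HSubstS N₀ Γ.length α₀ S S' → HSubstA N₀ Γ.length α₀ A A' →
      HSubstCtx N₀ α₀ ((S, A) :: Γ) ((S', A') :: Γ')

/-! ### Canonical LF -/

mutual
  /-- `Γ ⊢ R ⇒ A`: the atomic term `R` synthesizes the type `A`. -/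
  inductive LFSynth : LFSig → LFCtx → Atm → Ty → Prop where
    | const {Sg : LFSig} {Γ : LFCtx} {c : TmConst} {A : Ty} :
        LFDecl.tm c A ∈ Sg → LFSynth Sg Γ (.const c) A
    | var {Sg : LFSig} {Γ : LFCtx} {i : ℕ} {A : Ty} :
        Γ[i]? = some A → LFSynth Sg Γ (.var i) (A.shift (i + 1))
    | app {Sg : LFSig} {Γ : LFCtx} {R₁ : Atm} {N₂ : Nrm} {A₂ A A' : Ty} :
        LFSynth Sg Γ R₁ (.pi A₂ A) → LFCheck Sg Γ N₂ A₂ → HSubstA N₂ 0 A₂.simple A A' →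
        LFSynth Sg Γ (.app R₁ N₂) A'
  /-- `Γ ⊢ N ⇐ A`: the normal term `N` checks against the type `A`. -/
  inductive LFCheck : LFSig → LFCtx → Nrm → Ty → Prop where
    | atm {Sg : LFSig} {Γ : LFCtx} {R : Atm} {P : ATy} :
        LFSynth Sg Γ R (.atm P) → LFCheck Sg Γ (.atm R) (.atm P)
    | lam {Sg : LFSig} {Γ : LFCtx} {N : Nrm} {A B : Ty} :
        LFCheck Sg (A :: Γ) N B → LFCheck Sg Γ (.lam N) (.pi A B)
end

/-- `Γ ⊢ P ⇒ K`: the atomic type family `P` synthesizes the kind `K`. -/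
inductive LFSynthKind : LFSig → LFCtx → ATy → Kind → Prop where
  | const {Sg : LFSig} {Γ : LFCtx} {a : TyConst} {K : Kind} :
      LFDecl.ty a K ∈ Sg → LFSynthKind Sg Γ (.const a) K
  | app {Sg : LFSig} {Γ : LFCtx} {P : ATy} {N : Nrm} {A : Ty} {K K' : Kind} :
      LFSynthKind Sg Γ P (.pi A K) → LFCheck Sg Γ N A → HSubstK N 0 A.simple K K' →
      LFSynthKind Sg Γ (.app P N) K'

/-- `Γ ⊢ A ⇐ type`: `A` is a well-formed type. -/
inductive LFTyWf : LFSig → LFCtx → Ty → Prop where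
  | atm {Sg : LFSig} {Γ : LFCtx} {P : ATy} :
      LFSynthKind Sg Γ P .type → LFTyWf Sg Γ (.atm P)
  | pi {Sg : LFSig} {Γ : LFCtx} {A₁ A₂ : Ty} :
      LFTyWf Sg Γ A₁ → LFTyWf Sg (A₁ :: Γ) A₂ → LFTyWf Sg Γ (.pi A₁ A₂)

/-- `Γ ⊢ K ⇐ kind`: `K` is a well-formed kind. -/
inductive LFKindWf : LFSig → LFCtx → Kind → Prop where
  | type {Sg : LFSig} {Γ : LFCtx} : LFKindWf Sg Γ .type
  | pi {Sg : LFSig} {Γ : LFCtx} {A : Ty} {K : Kind} :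
      LFTyWf Sg Γ A → LFKindWf Sg (A :: Γ) K → LFKindWf Sg Γ (.pi A K)

/-- `⊢ Γ ctx`, for LF contexts. -/
inductive LFCtxWf : LFSig → LFCtx → Prop where
  | nil {Sg : LFSig} : LFCtxWf Sg []
  | cons {Sg : LFSig} {Γ : LFCtx} {A : Ty} :
      LFCtxWf Sg Γ → LFTyWf Sg Γ A → LFCtxWf Sg (A :: Γ)

/-! ### LF with refinements -/

/-- One declared step of subsorting between atomic sorts: `s₁ N⃗ ≤ s₂ N⃗` for `s₁ ≤ s₂` in `Σ`. -/
inductive SubStep : Sig → ASrt → ASrt → Prop where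
  | decl {Sg : Sig} {s₁ s₂ : SrtConst} :
      Decl.sub s₁ s₂ ∈ Sg → SubStep Sg (.const s₁) (.const s₂)
  | app {Sg : Sig} {Q₁ Q₂ : ASrt} {N : Nrm} :
      SubStep Sg Q₁ Q₂ → SubStep Sg (.app Q₁ N) (.app Q₂ N)

/-- Subsorting `Q₁ ≤ Q₂` between atomic sorts. -/
inductive Subsort : Sig → ASrt → ASrt → Prop where
  | refl {Sg : Sig} {Q : ASrt} : Subsort Sg Q Q
  | step {Sg : Sig} {Q₁ Q' Q₂ : ASrt} :
      SubStep Sg Q₁ Q' → Subsort Sg Q' Q₂ → Subsort Sg Q₁ Q₂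

mutual
  /-- `Γ ⊢ R ⇒ S`: the atomic term `R` synthesizes the sort `S`. -/
  inductive Synth : Sig → Ctx → Atm → Srt → Prop where
    | const {Sg : Sig} {Γ : Ctx} {c : TmConst} {S : Srt} :
        Decl.tmSrt c S ∈ Sg → Synth Sg Γ (.const c) S
    | var {Sg : Sig} {Γ : Ctx} {i : ℕ} {S : Srt} {A : Ty} :
        Γ[i]? = some (S, A) → Synth Sg Γ (.var i) (S.shift (i + 1))
    | app {Sg : Sig} {Γ : Ctx} {R₁ : Atm} {N₂ : Nrm} {S₂ S S' : Srt} {A₂ : Ty} :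
        Synth Sg Γ R₁ (.pi S₂ A₂ S) → Check Sg Γ N₂ S₂ → HSubstS N₂ 0 A₂.simple S S' →
        Synth Sg Γ (.app R₁ N₂) S'
    | interE₁ {Sg : Sig} {Γ : Ctx} {R : Atm} {S₁ S₂ : Srt} :
        Synth Sg Γ R (.inter S₁ S₂) → Synth Sg Γ R S₁
    | interE₂ {Sg : Sig} {Γ : Ctx} {R : Atm} {S₁ S₂ : Srt} :
        Synth Sg Γ R (.inter S₁ S₂) → Synth Sg Γ R S₂
  /-- `Γ ⊢ N ⇐ S`: the normal term `N` checks against the sort `S`. -/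
  inductive Check : Sig → Ctx → Nrm → Srt → Prop where
    | switch {Sg : Sig} {Γ : Ctx} {R : Atm} {Q' Q : ASrt} :
        Synth Sg Γ R (.atm Q') → Subsort Sg Q' Q → Check Sg Γ (.atm R) (.atm Q)
    | lam {Sg : Sig} {Γ : Ctx} {N : Nrm} {S S' : Srt} {A : Ty} :
        Check Sg ((S, A) :: Γ) N S' → Check Sg Γ (.lam N) (.pi S A S')
    | top {Sg : Sig} {Γ : Ctx} {N : Nrm} : Check Sg Γ N .top
    | inter {Sg : Sig} {Γ : Ctx} {N : Nrm} {S₁ S₂ : Srt} :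
        Check Sg Γ N S₁ → Check Sg Γ N S₂ → Check Sg Γ N (.inter S₁ S₂)
end

/-- `Γ ⊢ Q ⊏ P ⇒ L`: the atomic sort family `Q` refines `P` and synthesizes the class `L`. -/
inductive SynthCls : Sig → Ctx → ASrt → ATy → Cls → Prop where
  | const {Sg : Sig} {Γ : Ctx} {s : SrtConst} {a : TyConst} {L : Cls} :
      Decl.srt s a L ∈ Sg → SynthCls Sg Γ (.const s) (.const a) L
  | app {Sg : Sig} {Γ : Ctx} {Q : ASrt} {P : ATy} {N : Nrm} {S : Srt} {A : Ty} {L L' : Cls} :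
      SynthCls Sg Γ Q P (.pi S A L) → Check Sg Γ N S → HSubstL N 0 A.simple L L' →
      SynthCls Sg Γ (.app Q N) (.app P N) L'
  | interE₁ {Sg : Sig} {Γ : Ctx} {Q : ASrt} {P : ATy} {L₁ L₂ : Cls} :
      SynthCls Sg Γ Q P (.inter L₁ L₂) → SynthCls Sg Γ Q P L₁
  | interE₂ {Sg : Sig} {Γ : Ctx} {Q : ASrt} {P : ATy} {L₁ L₂ : Cls} :
      SynthCls Sg Γ Q P (.inter L₁ L₂) → SynthCls Sg Γ Q P L₂

/-- `Γ ⊢ S ⊏ A`: `S` is a well-formed sort refining the type `A`. -/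
inductive Refines : Sig → Ctx → Srt → Ty → Prop where
  | atm {Sg : Sig} {Γ : Ctx} {Q : ASrt} {P : ATy} :
      SynthCls Sg Γ Q P .sort → Refines Sg Γ (.atm Q) (.atm P)
  | pi {Sg : Sig} {Γ : Ctx} {S S' : Srt} {A A' : Ty} :
      Refines Sg Γ S A → Refines Sg ((S, A) :: Γ) S' A' →
      Refines Sg Γ (.pi S A S') (.pi A A')
  | top {Sg : Sig} {Γ : Ctx} {A : Ty} : Refines Sg Γ .top A
  | inter {Sg : Sig} {Γ : Ctx} {S₁ S₂ : Srt} {A : Ty} :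
      Refines Sg Γ S₁ A → Refines Sg Γ S₂ A → Refines Sg Γ (.inter S₁ S₂) A

/-- `Γ ⊢ L ⊏ K`: `L` is a well-formed class refining the kind `K`. -/
inductive RefinesCls : Sig → Ctx → Cls → Kind → Prop where
  | sort {Sg : Sig} {Γ : Ctx} : RefinesCls Sg Γ .sort .type
  | pi {Sg : Sig} {Γ : Ctx} {S : Srt} {A : Ty} {L : Cls} {K : Kind} :
      Refines Sg Γ S A → RefinesCls Sg ((S, A) :: Γ) L K →
      RefinesCls Sg Γ (.pi S A L) (.pi A K)
  | top {Sg : Sig} {Γ : Ctx} {K : Kind} : RefinesCls Sg Γ .top K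
  | inter {Sg : Sig} {Γ : Ctx} {L₁ L₂ : Cls} {K : Kind} :
      RefinesCls Sg Γ L₁ K → RefinesCls Sg Γ L₂ K → RefinesCls Sg Γ (.inter L₁ L₂) K

/-- `⊢ Γ ctx`, for LFR contexts. -/
inductive CtxWf : Sig → Ctx → Prop where
  | nil {Sg : Sig} : CtxWf Sg []
  | cons {Sg : Sig} {Γ : Ctx} {S : Srt} {A : Ty} :
      CtxWf Sg Γ → Refines Sg Γ S A → CtxWf Sg ((S, A) :: Γ)

/-- `⊢ Σ sig`: well-formed LFR signatures. -/
inductive SigWf : Sig → Prop where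
  | nil : SigWf []
  | ty {Sg : Sig} {a : TyConst} {K : Kind} :
      SigWf Sg → LFKindWf (Sig.erase Sg) [] K → (∀ K', Decl.ty a K' ∉ Sg) →
      SigWf (.ty a K :: Sg)
  | tm {Sg : Sig} {c : TmConst} {A : Ty} :
      SigWf Sg → LFTyWf (Sig.erase Sg) [] A → (∀ A', Decl.tm c A' ∉ Sg) →
      SigWf (.tm c A :: Sg)
  | srt {Sg : Sig} {s : SrtConst} {a : TyConst} {K : Kind} {L : Cls} :
      SigWf Sg → Decl.ty a K ∈ Sg → RefinesCls Sg [] L K →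
      (∀ a' L', Decl.srt s a' L' ∉ Sg) → SigWf (.srt s a L :: Sg)
  | tmSrt {Sg : Sig} {c : TmConst} {A : Ty} {S : Srt} :
      SigWf Sg → Decl.tm c A ∈ Sg → Refines Sg [] S A →
      (∀ S', Decl.tmSrt c S' ∉ Sg) → SigWf (.tmSrt c S :: Sg)
  | sub {Sg : Sig} {s₁ s₂ : SrtConst} {a : TyConst} {L : Cls} :
      SigWf Sg → Decl.srt s₁ a L ∈ Sg → Decl.srt s₂ a L ∈ Sg →
      SigWf (.sub s₁ s₂ :: Sg)

end LFR

/-!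
Both halves of the theorem are inductions on the simple type `α₀` of the replaced variable, with an
inner induction on derivations. The only place where the outer induction is needed is an
application `R N` whose head is the replaced variable: there `[N₀/x₀] R` is some `λx. N₁`, and its
body is substituted into at the domain of the simple type of `R`, which is smaller than `α₀`.
The LF half is the one that shows that substitution is defined; its LFR counterpart presupposes
that the results on terms exist, because checking against `⊤` says nothing about a term. Passing
an application through a substitution exchanges two substitutions, which is the composition law
`[N₀/x₀][N₂/x] = [[N₀/x₀]N₂/x][N₀/x₀]`.
-/

namespace LFR

/-! ### Renaming -/

/-- Renaming of the free variables of a kind. -/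
def Kind.ren (ρ : ℕ → ℕ) : Kind → Kind
  | .type => .type
  | .pi A K => .pi (A.ren ρ) (K.ren (upRen ρ))

/-- Renaming of the free variables of a class. -/
def Cls.ren (ρ : ℕ → ℕ) : Cls → Cls
  | .sort => .sort
  | .pi S A L => .pi (S.ren ρ) (A.ren ρ) (L.ren (upRen ρ))
  | .top => .top
  | .inter L₁ L₂ => .inter (L₁.ren ρ) (L₂.ren ρ)

theorem upRen_id : upRen id = id := by
  funext i; cases i <;> rfl

theorem upRen_comp (σ ρ : ℕ → ℕ) : upRen σ ∘ upRen ρ = upRen (σ ∘ ρ) := by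
  funext i; cases i <;> rfl

theorem upRen_eq_self {ρ : ℕ → ℕ} {n : ℕ} (h : ∀ i < n, ρ i = i) : ∀ i < n + 1, upRen ρ i = i
  | 0, _ => rfl
  | i + 1, hi => congrArg (· + 1) (h i (by omega))

mutual
theorem Atm.ren_id : ∀ R : Atm, R.ren id = R
  | .const _ => rfl
  | .var _ => rfl
  | .app R N => by rw [Atm.ren, Atm.ren_id R, Nrm.ren_id N]
theorem Nrm.ren_id : ∀ N : Nrm, N.ren id = N
  | .atm R => by rw [Nrm.ren, Atm.ren_id R]
  | .lam N => by rw [Nrm.ren, upRen_id, Nrm.ren_id N]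
end

mutual
theorem Atm.ren_ren (σ ρ : ℕ → ℕ) : ∀ R : Atm, (R.ren ρ).ren σ = R.ren (σ ∘ ρ)
  | .const _ => rfl
  | .var _ => rfl
  | .app R N => by simp only [Atm.ren, Atm.ren_ren σ ρ R, Nrm.ren_ren σ ρ N]
theorem Nrm.ren_ren (σ ρ : ℕ → ℕ) : ∀ N : Nrm, (N.ren ρ).ren σ = N.ren (σ ∘ ρ)
  | .atm R => by simp only [Nrm.ren, Atm.ren_ren σ ρ R]
  | .lam N => by simp only [Nrm.ren, Nrm.ren_ren _ _ N, upRen_comp]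
end

theorem ATy.ren_ren (σ ρ : ℕ → ℕ) (P : ATy) : (P.ren ρ).ren σ = P.ren (σ ∘ ρ) := by
  induction P with
  | const a => rfl
  | app P N ih => simp only [ATy.ren, ih, Nrm.ren_ren]

theorem Ty.ren_ren (σ ρ : ℕ → ℕ) (A : Ty) : (A.ren ρ).ren σ = A.ren (σ ∘ ρ) := by
  induction A generalizing σ ρ with
  | atm P => simp only [Ty.ren, ATy.ren_ren]
  | pi A₁ A₂ ih₁ ih₂ => simp only [Ty.ren, ih₁, ih₂, upRen_comp]

theorem ASrt.ren_ren (σ ρ : ℕ → ℕ) (Q : ASrt) : (Q.ren ρ).ren σ = Q.ren (σ ∘ ρ) := by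
  induction Q with
  | const s => rfl
  | app Q N ih => simp only [ASrt.ren, ih, Nrm.ren_ren]

theorem Srt.ren_ren (σ ρ : ℕ → ℕ) (S : Srt) : (S.ren ρ).ren σ = S.ren (σ ∘ ρ) := by
  induction S generalizing σ ρ with
  | atm Q => simp only [Srt.ren, ASrt.ren_ren]
  | pi S₁ A₁ S₂ ih₁ ih₂ => simp only [Srt.ren, ih₁, ih₂, Ty.ren_ren, upRen_comp]
  | top => rfl
  | inter S₁ S₂ ih₁ ih₂ => simp only [Srt.ren, ih₁, ih₂]

theorem ATy.head_ren (ρ : ℕ → ℕ) (P : ATy) : (P.ren ρ).head = P.head := by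
  induction P with
  | const => rfl
  | app _ _ ih => exact ih

theorem Ty.simple_ren (ρ : ℕ → ℕ) (A : Ty) : (A.ren ρ).simple = A.simple := by
  induction A generalizing ρ with
  | atm P => simp only [Ty.ren, Ty.simple, ATy.head_ren]
  | pi A₁ A₂ ih₁ ih₂ => simp only [Ty.ren, Ty.simple, ih₁, ih₂]

theorem Nrm.shift_zero (N : Nrm) : N.shift 0 = N := Nrm.ren_id N

theorem Nrm.shift_shift (n m : ℕ) (N : Nrm) : (N.shift n).shift m = N.shift (n + m) :=
  (Nrm.ren_ren _ _ N).trans (congrArg (Nrm.ren · N) (funext fun i => Nat.add_assoc i n m))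

theorem Ty.shift_shift (n m : ℕ) (A : Ty) : (A.shift n).shift m = A.shift (n + m) :=
  (Ty.ren_ren _ _ A).trans (congrArg (Ty.ren · A) (funext fun i => Nat.add_assoc i n m))

theorem Srt.shift_shift (n m : ℕ) (S : Srt) : (S.shift n).shift m = S.shift (n + m) :=
  (Srt.ren_ren _ _ S).trans (congrArg (Srt.ren · S) (funext fun i => Nat.add_assoc i n m))

theorem Nrm.shift_one_ren (ρ : ℕ → ℕ) (N : Nrm) :
    (N.shift 1).ren (upRen ρ) = (N.ren ρ).shift 1 :=
  (Nrm.ren_ren _ _ N).trans (Nrm.ren_ren (· + 1) ρ N).symm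

theorem Ty.shift_one_ren (ρ : ℕ → ℕ) (A : Ty) :
    (A.shift 1).ren (upRen ρ) = (A.ren ρ).shift 1 :=
  (Ty.ren_ren _ _ A).trans (Ty.ren_ren (· + 1) ρ A).symm

theorem Srt.shift_one_ren (ρ : ℕ → ℕ) (S : Srt) :
    (S.shift 1).ren (upRen ρ) = (S.ren ρ).shift 1 :=
  (Srt.ren_ren _ _ S).trans (Srt.ren_ren (· + 1) ρ S).symm

/-- The weakening that makes room for a new variable of index `k`. Its values are the indices of
the variables other than `k`, and substitution for `k` turns the variable `skip k i` into `i`. -/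
def skip (k i : ℕ) : ℕ := if i < k then i else i + 1

theorem upRen_skip (k : ℕ) : upRen (skip k) = skip (k + 1) := by
  funext i
  cases i with
  | zero => simp [upRen, skip]
  | succ i => simp only [upRen, skip]; split_ifs <;> omega

theorem skip_add (k n i : ℕ) : skip (k + n) (i + n) = skip k i + n := by
  unfold skip; split_ifs <;> omega

theorem skip_of_le {k i : ℕ} (h : k ≤ i) : skip k i = i + 1 := if_neg (by omega)

theorem eq_or_exists_eq_skip (k i : ℕ) : i = k ∨ ∃ j, i = skip k j := by
  rcases lt_trichotomy i k with h | h | h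
  · exact .inr ⟨i, (if_pos h).symm⟩
  · exact .inl h
  · exact .inr ⟨i - 1, by rw [skip_of_le (by omega)]; omega⟩

/-- The simplicial identity for the maps `skip`: omitting two variables in either order is
omitting both. -/
theorem exists_eq_skip_of_skip_eq_skip {j n i i' : ℕ} (hj : j ≤ n)
    (h : skip j i = skip (n + 1) i') : ∃ l, i = skip n l ∧ i' = skip j l := by
  unfold skip at *
  rcases lt_or_ge i n with hi | hi
  · exact ⟨i, by split_ifs at * <;> omega, by split_ifs at * <;> omega⟩
  · exact ⟨i - 1, by split_ifs at * <;> omega, by split_ifs at * <;> omega⟩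

/-! ### Hereditary substitution and renaming -/

section Skip

variable {N₀ : Nrm} {α : STy}

theorem HSubstRR.var_skip (k i : ℕ) : HSubstRR N₀ k α (.var (skip k i)) (.var i) := by
  rcases lt_or_ge i k with h | h
  · rw [skip, if_pos h]; exact .varLt h
  · rw [skip_of_le h]; exact .varGt h

theorem HSubstRR.exists_eq_skip {k i : ℕ} {R : Atm} (h : HSubstRR N₀ k α (.var i) R) :
    ∃ i', i = skip k i' ∧ R = .var i' := by
  cases h with
  | varLt h => exact ⟨i, (if_pos h).symm, rfl⟩
  | varGt h => exact ⟨_, (skip_of_le h).symm, rfl⟩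

mutual
theorem HSubstRR.ren_skip (k : ℕ) : ∀ R : Atm, HSubstRR N₀ k α (R.ren (skip k)) R
  | .const _ => .const
  | .var i => .var_skip k i
  | .app R N => .app (HSubstRR.ren_skip k R) (HSubstN.ren_skip k N)
theorem HSubstN.ren_skip (k : ℕ) : ∀ N : Nrm, HSubstN N₀ k α (N.ren (skip k)) N
  | .atm R => .atm (HSubstRR.ren_skip k R)
  | .lam N => .lam (upRen_skip k ▸ HSubstN.ren_skip (k + 1) N)
end

theorem HSubstP.ren_skip (k : ℕ) (P : ATy) : HSubstP N₀ k α (P.ren (skip k)) P := by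
  induction P with
  | const a => exact .const
  | app P N ih => exact .app ih (.ren_skip k N)

theorem HSubstA.ren_skip (k : ℕ) (A : Ty) : HSubstA N₀ k α (A.ren (skip k)) A := by
  induction A generalizing k with
  | atm P => exact .atm (.ren_skip k P)
  | pi A₁ A₂ ih₁ ih₂ => exact .pi (ih₁ k) (upRen_skip k ▸ ih₂ (k + 1))

theorem HSubstK.ren_skip (k : ℕ) (K : Kind) : HSubstK N₀ k α (K.ren (skip k)) K := by
  induction K generalizing k with
  | type => exact .type
  | pi A K ih => exact .pi (.ren_skip k A) (upRen_skip k ▸ ih (k + 1))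

theorem HSubstQ.ren_skip (k : ℕ) (Q : ASrt) : HSubstQ N₀ k α (Q.ren (skip k)) Q := by
  induction Q with
  | const s => exact .const
  | app Q N ih => exact .app ih (.ren_skip k N)

theorem HSubstS.ren_skip (k : ℕ) (S : Srt) : HSubstS N₀ k α (S.ren (skip k)) S := by
  induction S generalizing k with
  | atm Q => exact .atm (.ren_skip k Q)
  | pi S₁ A₁ S₂ ih₁ ih₂ => exact .pi (ih₁ k) (.ren_skip k A₁) (upRen_skip k ▸ ih₂ (k + 1))
  | top => exact .top
  | inter S₁ S₂ ih₁ ih₂ => exact .inter (ih₁ k) (ih₂ k)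

theorem HSubstL.ren_skip (k : ℕ) (L : Cls) : HSubstL N₀ k α (L.ren (skip k)) L := by
  induction L generalizing k with
  | sort => exact .sort
  | pi S A L ih => exact .pi (.ren_skip k S) (.ren_skip k A) (upRen_skip k ▸ ih (k + 1))
  | top => exact .top
  | inter L₁ L₂ ih₁ ih₂ => exact .inter (ih₁ k) (ih₂ k)

theorem HSubstN.shift_succ {k n : ℕ} (h : k ≤ n) (N : Nrm) :
    HSubstN N₀ k α (N.shift (n + 1)) (N.shift n) := by
  have hskip : skip k ∘ (· + n) = (· + (n + 1)) :=
    funext fun i => skip_of_le (h.trans (Nat.le_add_left n i))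
  simpa only [Nrm.shift, Nrm.ren_ren, hskip] using HSubstN.ren_skip k (N.shift n)

theorem HSubstA.shift_succ (n : ℕ) (A : Ty) : HSubstA N₀ 0 α (A.shift (n + 1)) (A.shift n) := by
  rw [← Ty.shift_shift]
  exact .ren_skip 0 (A.shift n)

theorem HSubstS.shift_succ (n : ℕ) (S : Srt) : HSubstS N₀ 0 α (S.shift (n + 1)) (S.shift n) := by
  rw [← Srt.shift_shift]
  exact .ren_skip 0 (S.shift n)

end Skip

/-- The renamings `ρ` of the subject and `ρ'` of the result carry the substitution of `N₀` for the
variable `k` to the substitution of `N₀'` for the variable `k'`. -/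
structure RenSub (N₀ : Nrm) (k : ℕ) (N₀' : Nrm) (k' : ℕ) (ρ ρ' : ℕ → ℕ) : Prop where
  target : ρ k = k'
  comp_skip : ρ ∘ skip k = skip k' ∘ ρ'
  term : (N₀.shift k).ren ρ' = N₀'.shift k'

theorem RenSub.up {N₀ N₀' : Nrm} {k k' : ℕ} {ρ ρ' : ℕ → ℕ} (h : RenSub N₀ k N₀' k' ρ ρ') :
    RenSub N₀ (k + 1) N₀' (k' + 1) (upRen ρ) (upRen ρ') where
  target := congrArg (· + 1) h.target
  comp_skip := by rw [← upRen_skip, ← upRen_skip, upRen_comp, upRen_comp, h.comp_skip]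
  term := by rw [← Nrm.shift_shift, Nrm.shift_one_ren, h.term, Nrm.shift_shift]

theorem RenSub.zero (N₀ : Nrm) (ρ : ℕ → ℕ) : RenSub N₀ 0 (N₀.ren ρ) 0 (upRen ρ) ρ where
  target := rfl
  comp_skip := rfl
  term := by rw [Nrm.shift_zero, Nrm.shift_zero]

theorem RenSub.add (N₀ : Nrm) (k n : ℕ) : RenSub N₀ k N₀ (k + n) (· + n) (· + n) where
  target := rfl
  comp_skip := funext fun i => (skip_add k n i).symm
  term := Nrm.shift_shift k n N₀

theorem RenSub.hsubstRR_var {N₀ N₀' : Nrm} {k k' i i' : ℕ} {α : STy} {ρ ρ' : ℕ → ℕ}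
    (hr : RenSub N₀ k N₀' k' ρ ρ') (h : HSubstRR N₀ k α (.var i) (.var i')) :
    HSubstRR N₀' k' α (.var (ρ i)) (.var (ρ' i')) := by
  obtain ⟨_, rfl, ⟨⟩⟩ := h.exists_eq_skip
  rw [show ρ (skip k i') = skip k' (ρ' i') from congrFun hr.comp_skip i']
  exact .var_skip k' _

mutual
theorem HSubstN.ren {N₀ N₀' N N' : Nrm} {k k' : ℕ} {α : STy} {ρ ρ' : ℕ → ℕ}
    (hr : RenSub N₀ k N₀' k' ρ ρ') :
    HSubstN N₀ k α N N' → HSubstN N₀' k' α (N.ren ρ) (N'.ren ρ')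
  | .atm h => .atm (h.ren hr)
  | .atmNorm h => .atmNorm (HSubstRN.ren hr h)
  | .lam h => .lam (h.ren hr.up)
theorem HSubstRR.ren {N₀ N₀' : Nrm} {R R' : Atm} {k k' : ℕ} {α : STy} {ρ ρ' : ℕ → ℕ}
    (hr : RenSub N₀ k N₀' k' ρ ρ') :
    HSubstRR N₀ k α R R' → HSubstRR N₀' k' α (R.ren ρ) (R'.ren ρ')
  | .varLt h => hr.hsubstRR_var (.varLt h)
  | .varGt h => hr.hsubstRR_var (.varGt h)
  | .const => .const
  | .app h₁ h₂ => .app (h₁.ren hr) (h₂.ren hr)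
theorem HSubstRN.ren {N₀ N₀' N' : Nrm} {R : Atm} {k k' : ℕ} {α β : STy} {ρ ρ' : ℕ → ℕ}
    (hr : RenSub N₀ k N₀' k' ρ ρ') :
    HSubstRN N₀ k α R N' β → HSubstRN N₀' k' α (R.ren ρ) (N'.ren ρ') β
  | .var => by rw [Atm.ren, hr.target, hr.term]; exact .var
  | .beta h₁ h₂ h₃ => .beta (h₁.ren hr) (h₂.ren hr) (h₃.ren (.zero _ _))
end

section Ren

variable {N₀ N₀' : Nrm} {k k' : ℕ} {α : STy} {ρ ρ' : ℕ → ℕ}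

theorem HSubstP.ren {P P' : ATy} (hr : RenSub N₀ k N₀' k' ρ ρ') (h : HSubstP N₀ k α P P') :
    HSubstP N₀' k' α (P.ren ρ) (P'.ren ρ') := by
  induction h with
  | const => exact .const
  | app _ h ih => exact .app ih (h.ren hr)

theorem HSubstA.ren {A A' : Ty} (hr : RenSub N₀ k N₀' k' ρ ρ') (h : HSubstA N₀ k α A A') :
    HSubstA N₀' k' α (A.ren ρ) (A'.ren ρ') := by
  induction h generalizing k' ρ ρ' with
  | atm h => exact .atm (h.ren hr)
  | pi _ _ ih₁ ih₂ => exact .pi (ih₁ hr) (ih₂ hr.up)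

theorem HSubstQ.ren {Q Q' : ASrt} (hr : RenSub N₀ k N₀' k' ρ ρ') (h : HSubstQ N₀ k α Q Q') :
    HSubstQ N₀' k' α (Q.ren ρ) (Q'.ren ρ') := by
  induction h with
  | const => exact .const
  | app _ h ih => exact .app ih (h.ren hr)

theorem HSubstS.ren {S S' : Srt} (hr : RenSub N₀ k N₀' k' ρ ρ') (h : HSubstS N₀ k α S S') :
    HSubstS N₀' k' α (S.ren ρ) (S'.ren ρ') := by
  induction h generalizing k' ρ ρ' with
  | atm h => exact .atm (h.ren hr)
  | pi _ h _ ih₁ ih₂ => exact .pi (ih₁ hr) (h.ren hr) (ih₂ hr.up)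
  | top => exact .top
  | inter _ _ ih₁ ih₂ => exact .inter (ih₁ hr) (ih₂ hr)

end Ren

/-! ### Determinism and composition of hereditary substitutions -/

theorem HSubstRR.not_hsubstRN {N₀ N : Nrm} {k : ℕ} {α β : STy} {R R' : Atm} :
    HSubstRR N₀ k α R R' → ¬ HSubstRN N₀ k α R N β
  | .varLt h, h' => by cases h'; omega
  | .varGt h, h' => by cases h'; omega
  | .const, h' => by cases h'
  | .app h _, .beta h' _ _ => h.not_hsubstRN h'

theorem HSubstRN.index_unique {N₀ N₀' N N' : Nrm} {k k' : ℕ} {α α' β β' : STy} {R : Atm} :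
    HSubstRN N₀ k α R N β → HSubstRN N₀' k' α' R N' β' → k = k'
  | .var, h' => by cases h'; rfl
  | .beta h _ _, h' => by cases h' with | beta h' => exact h.index_unique h'

mutual
theorem HSubstN.unique {N₀ N N₁ N₂ : Nrm} {k : ℕ} {α : STy} :
    HSubstN N₀ k α N N₁ → HSubstN N₀ k α N N₂ → N₁ = N₂
  | .atm h, .atm h' => congrArg _ (h.unique h')
  | .atm h, .atmNorm h' => (h.not_hsubstRN h').elim
  | .atmNorm h, .atm h' => (h'.not_hsubstRN h).elim
  | .atmNorm h, .atmNorm h' => (HSubstRN.unique h h').1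
  | .lam h, .lam h' => congrArg _ (h.unique h')
theorem HSubstRR.unique {N₀ : Nrm} {R R₁ R₂ : Atm} {k : ℕ} {α : STy} :
    HSubstRR N₀ k α R R₁ → HSubstRR N₀ k α R R₂ → R₁ = R₂
  | .varLt h, h' => by
    cases h' with
    | varLt => rfl
    | varGt => omega
  | .varGt h, h' => by
    cases h' with
    | varLt => omega
    | varGt => rfl
  | .const, .const => rfl
  | .app h₁ h₂, .app h₁' h₂' => congrArg₂ _ (h₁.unique h₁') (h₂.unique h₂')
theorem HSubstRN.unique {N₀ N₁ N₂ : Nrm} {R : Atm} {k : ℕ} {α β₁ β₂ : STy} :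
    HSubstRN N₀ k α R N₁ β₁ → HSubstRN N₀ k α R N₂ β₂ → N₁ = N₂ ∧ β₁ = β₂
  | .var, .var => ⟨rfl, rfl⟩
  | .beta h₁ h₂ h₃, .beta h₁' h₂' h₃' => by
    obtain ⟨⟨⟩, ⟨⟩⟩ := h₁.unique h₁'
    cases h₂.unique h₂'
    exact ⟨h₃.unique h₃', rfl⟩
end

section Unique

variable {N₀ : Nrm} {k : ℕ} {α : STy}

theorem HSubstP.unique {P P₁ P₂ : ATy} (h : HSubstP N₀ k α P P₁) (h' : HSubstP N₀ k α P P₂) :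
    P₁ = P₂ := by
  induction h generalizing P₂ with
  | const => cases h'; rfl
  | app _ h ih => cases h' with | app h₁ h₂ => rw [ih h₁, h.unique h₂]

theorem HSubstA.unique {A A₁ A₂ : Ty} (h : HSubstA N₀ k α A A₁) (h' : HSubstA N₀ k α A A₂) :
    A₁ = A₂ := by
  induction h generalizing A₂ with
  | atm h => cases h' with | atm h' => rw [h.unique h']
  | pi _ _ ih₁ ih₂ => cases h' with | pi h₁ h₂ => rw [ih₁ h₁, ih₂ h₂]

theorem HSubstQ.unique {Q Q₁ Q₂ : ASrt} (h : HSubstQ N₀ k α Q Q₁) (h' : HSubstQ N₀ k α Q Q₂) :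
    Q₁ = Q₂ := by
  induction h generalizing Q₂ with
  | const => cases h'; rfl
  | app _ h ih => cases h' with | app h₁ h₂ => rw [ih h₁, h.unique h₂]

end Unique

theorem HSubstRN.sizeOf_le {N₀ N : Nrm} {k : ℕ} {α β : STy} {R : Atm}
    (h : HSubstRN N₀ k α R N β) : sizeOf β ≤ sizeOf α :=
  match h with
  | .var => le_rfl
  | .beta h _ _ => by
    have hle := h.sizeOf_le
    simp only [STy.arrow.sizeOf_spec] at hle
    omega

mutual
theorem HSubstN.comp {α₀ α₂ : STy} {N₀ N₂ N₂' : Nrm} {m : ℕ} (h₂ : HSubstN N₀ m α₀ N₂ N₂') :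
    ∀ (N : Nrm) {N' N'' : Nrm} {j : ℕ},
      HSubstN N₂ j α₂ N N' → HSubstN N₀ (m + j + 1) α₀ N N'' →
      ∃ M, HSubstN N₀ (m + j) α₀ N' M ∧ HSubstN N₂' j α₂ N'' M
  | .atm R, _, _, _, .atm h, .atm h' => by
    obtain ⟨M, hM, hM'⟩ := HSubstRR.comp h₂ R h h'
    exact ⟨_, .atm hM, .atm hM'⟩
  | .atm R, _, _, _, .atm h, .atmNorm h' => by
    obtain ⟨M, hM, hM'⟩ := HSubstRR.comp_hsubstRN h₂ R h h'
    cases hM' with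
    | atm hM' => exact ⟨_, .atmNorm hM, .atm hM'⟩
    | atmNorm hM' => exact ⟨_, .atmNorm hM, .atmNorm hM'⟩
  | .atm R, _, _, _, .atmNorm h, .atm h' => by
    obtain ⟨M, hM, hM'⟩ := HSubstRN.comp_hsubstRR h₂ R h h'
    cases hM with
    | atm hM => exact ⟨_, .atm hM, .atmNorm hM'⟩
    | atmNorm hM => exact ⟨_, .atmNorm hM, .atmNorm hM'⟩
  | .atm _, _, _, _, .atmNorm h, .atmNorm h' => by
    have := h.index_unique h'
    omega
  | .lam N, _, _, _, .lam h, .lam h' => by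
    obtain ⟨M, hM, hM'⟩ := HSubstN.comp h₂ N h h'
    exact ⟨_, .lam hM, .lam hM'⟩
  termination_by N => (sizeOf α₀ + sizeOf α₂, sizeOf N)
theorem HSubstRR.comp {α₀ α₂ : STy} {N₀ N₂ N₂' : Nrm} {m : ℕ} (h₂ : HSubstN N₀ m α₀ N₂ N₂') :
    ∀ (R : Atm) {R' R'' : Atm} {j : ℕ},
      HSubstRR N₂ j α₂ R R' → HSubstRR N₀ (m + j + 1) α₀ R R'' →
      ∃ M, HSubstRR N₀ (m + j) α₀ R' M ∧ HSubstRR N₂' j α₂ R'' M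
  | .const _, _, _, _, .const, .const => ⟨_, .const, .const⟩
  | .var i, _, _, j, h, h' => by
    obtain ⟨i', rfl, rfl⟩ := h.exists_eq_skip
    obtain ⟨i'', hi, rfl⟩ := h'.exists_eq_skip
    obtain ⟨l, rfl, rfl⟩ := exists_eq_skip_of_skip_eq_skip (Nat.le_add_left j m) hi
    exact ⟨_, .var_skip _ l, .var_skip _ l⟩
  | .app R N, _, _, _, .app hR hN, .app hR' hN' => by
    obtain ⟨M, hM, hM'⟩ := HSubstRR.comp h₂ R hR hR'
    obtain ⟨M₂, hM₂, hM₂'⟩ := HSubstN.comp h₂ N hN hN'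
    exact ⟨_, .app hM hM₂, .app hM' hM₂'⟩
  termination_by R => (sizeOf α₀ + sizeOf α₂, sizeOf R)
theorem HSubstRN.comp_hsubstRR {α₀ α₂ : STy} {N₀ N₂ N₂' : Nrm} {m : ℕ}
    (h₂ : HSubstN N₀ m α₀ N₂ N₂') :
    ∀ (R : Atm) {R'' : Atm} {N' : Nrm} {β : STy} {j : ℕ},
      HSubstRN N₂ j α₂ R N' β → HSubstRR N₀ (m + j + 1) α₀ R R'' →
      ∃ M, HSubstN N₀ (m + j) α₀ N' M ∧ HSubstRN N₂' j α₂ R'' M β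
  | .var _, _, _, _, j, .var, h' => by
    obtain ⟨i, hi, rfl⟩ := h'.exists_eq_skip
    obtain rfl : i = j := by unfold skip at hi; split_ifs at hi <;> omega
    exact ⟨_, h₂.ren (.add N₀ m i), .var⟩
  | .app R N, _, _, _, _, .beta hR hN hb, .app hR' hN' => by
    obtain ⟨M, ⟨⟩ | ⟨⟩ | ⟨hM⟩, hM'⟩ := HSubstRN.comp_hsubstRR h₂ R hR hR'
    obtain ⟨M₂, hM₂, hM₂'⟩ := HSubstN.comp h₂ N hN hN'
    have hlt := hR.sizeOf_le
    obtain ⟨M₃, hM₃, hM₃'⟩ := HSubstN.comp hM₂ _ hb hM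
    exact ⟨M₃, hM₃, .beta hM' hM₂' hM₃'⟩
  termination_by R => (sizeOf α₀ + sizeOf α₂, sizeOf R)
  decreasing_by
    all_goals simp_wf
    all_goals first
      | omega
      | exact Prod.Lex.left _ _ (by simp only [STy.arrow.sizeOf_spec] at hlt; omega)
theorem HSubstRR.comp_hsubstRN {α₀ α₂ : STy} {N₀ N₂ N₂' : Nrm} {m : ℕ}
    (h₂ : HSubstN N₀ m α₀ N₂ N₂') :
    ∀ (R : Atm) {R' : Atm} {N'' : Nrm} {β : STy} {j : ℕ},
      HSubstRR N₂ j α₂ R R' → HSubstRN N₀ (m + j + 1) α₀ R N'' β →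
      ∃ M, HSubstRN N₀ (m + j) α₀ R' M β ∧ HSubstN N₂' j α₂ N'' M
  | .var _, _, _, _, j, h, .var => by
    obtain ⟨i, hi, rfl⟩ := h.exists_eq_skip
    obtain rfl : i = m + j := by unfold skip at hi; split_ifs at hi <;> omega
    exact ⟨_, .var, .shift_succ (Nat.le_add_left j m) N₀⟩
  | .app R N, _, _, _, _, .app hR hN, .beta hR' hN' hb => by
    obtain ⟨M, hM, ⟨⟩ | ⟨⟩ | ⟨hM'⟩⟩ := HSubstRR.comp_hsubstRN h₂ R hR hR'
    obtain ⟨M₂, hM₂, hM₂'⟩ := HSubstN.comp h₂ N hN hN'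
    have hlt := hR'.sizeOf_le
    obtain ⟨M₃, hM₃, hM₃'⟩ := HSubstN.comp hM₂' _ hb hM'
    exact ⟨M₃, .beta hM hM₂ hM₃', hM₃⟩
  termination_by R => (sizeOf α₀ + sizeOf α₂, sizeOf R)
  decreasing_by
    all_goals simp_wf
    all_goals first
      | omega
      | exact Prod.Lex.left _ _ (by simp only [STy.arrow.sizeOf_spec] at hlt; omega)
end

section Comp

variable {N₀ N₂ N₂' : Nrm} {α₀ α₂ : STy} {j m : ℕ}

theorem HSubstP.comp {P P' P'' : ATy}
    (h₂ : HSubstN N₀ m α₀ N₂ N₂') (h : HSubstP N₂ j α₂ P P')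
    (h' : HSubstP N₀ (m + j + 1) α₀ P P'') :
    ∃ M, HSubstP N₀ (m + j) α₀ P' M ∧ HSubstP N₂' j α₂ P'' M := by
  induction P generalizing P' P'' with
  | const a => cases h; cases h'; exact ⟨_, .const, .const⟩
  | app P N ih =>
    cases h with | app hP hN => cases h' with | app hP' hN' =>
    obtain ⟨_, hM, hM'⟩ := ih hP hP'
    obtain ⟨_, hM₂, hM₂'⟩ := HSubstN.comp h₂ N hN hN'
    exact ⟨_, .app hM hM₂, .app hM' hM₂'⟩

theorem HSubstA.comp {A A' A'' : Ty}
    (h₂ : HSubstN N₀ m α₀ N₂ N₂') (h : HSubstA N₂ j α₂ A A')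
    (h' : HSubstA N₀ (m + j + 1) α₀ A A'') :
    ∃ M, HSubstA N₀ (m + j) α₀ A' M ∧ HSubstA N₂' j α₂ A'' M := by
  induction A generalizing A' A'' j with
  | atm P =>
    cases h with | atm h => cases h' with | atm h' =>
    obtain ⟨_, hM, hM'⟩ := h.comp h₂ h'
    exact ⟨_, .atm hM, .atm hM'⟩
  | pi A₁ A₂ ih₁ ih₂ =>
    cases h with | pi hA hB => cases h' with | pi hA' hB' =>
    obtain ⟨_, hM, hM'⟩ := ih₁ hA hA'
    obtain ⟨_, hM₂, hM₂'⟩ := ih₂ hB hB'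
    exact ⟨_, .pi hM hM₂, .pi hM' hM₂'⟩

theorem HSubstK.comp {K K' K'' : Kind}
    (h₂ : HSubstN N₀ m α₀ N₂ N₂') (h : HSubstK N₂ j α₂ K K')
    (h' : HSubstK N₀ (m + j + 1) α₀ K K'') :
    ∃ M, HSubstK N₀ (m + j) α₀ K' M ∧ HSubstK N₂' j α₂ K'' M := by
  induction K generalizing K' K'' j with
  | type => cases h; cases h'; exact ⟨_, .type, .type⟩
  | pi A K ih =>
    cases h with | pi hA hK => cases h' with | pi hA' hK' =>
    obtain ⟨_, hM, hM'⟩ := hA.comp h₂ hA'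
    obtain ⟨_, hM₂, hM₂'⟩ := ih hK hK'
    exact ⟨_, .pi hM hM₂, .pi hM' hM₂'⟩

theorem HSubstQ.comp {Q Q' Q'' : ASrt}
    (h₂ : HSubstN N₀ m α₀ N₂ N₂') (h : HSubstQ N₂ j α₂ Q Q')
    (h' : HSubstQ N₀ (m + j + 1) α₀ Q Q'') :
    ∃ M, HSubstQ N₀ (m + j) α₀ Q' M ∧ HSubstQ N₂' j α₂ Q'' M := by
  induction Q generalizing Q' Q'' with
  | const s => cases h; cases h'; exact ⟨_, .const, .const⟩
  | app Q N ih =>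
    cases h with | app hQ hN => cases h' with | app hQ' hN' =>
    obtain ⟨_, hM, hM'⟩ := ih hQ hQ'
    obtain ⟨_, hM₂, hM₂'⟩ := HSubstN.comp h₂ N hN hN'
    exact ⟨_, .app hM hM₂, .app hM' hM₂'⟩

theorem HSubstS.comp {S S' S'' : Srt}
    (h₂ : HSubstN N₀ m α₀ N₂ N₂') (h : HSubstS N₂ j α₂ S S')
    (h' : HSubstS N₀ (m + j + 1) α₀ S S'') :
    ∃ M, HSubstS N₀ (m + j) α₀ S' M ∧ HSubstS N₂' j α₂ S'' M := by
  induction S generalizing S' S'' j with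
  | atm Q =>
    cases h with | atm h => cases h' with | atm h' =>
    obtain ⟨_, hM, hM'⟩ := h.comp h₂ h'
    exact ⟨_, .atm hM, .atm hM'⟩
  | pi S₁ A₁ S₂ ih₁ ih₂ =>
    cases h with | pi hS hA hB => cases h' with | pi hS' hA' hB' =>
    obtain ⟨_, hM, hM'⟩ := ih₁ hS hS'
    obtain ⟨_, hM₁, hM₁'⟩ := hA.comp h₂ hA'
    obtain ⟨_, hM₂, hM₂'⟩ := ih₂ hB hB'
    exact ⟨_, .pi hM hM₁ hM₂, .pi hM' hM₁' hM₂'⟩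
  | top => cases h; cases h'; exact ⟨_, .top, .top⟩
  | inter S₁ S₂ ih₁ ih₂ =>
    cases h with | inter hS hT => cases h' with | inter hS' hT' =>
    obtain ⟨_, hM, hM'⟩ := ih₁ hS hS'
    obtain ⟨_, hM₂, hM₂'⟩ := ih₂ hT hT'
    exact ⟨_, .inter hM hM₂, .inter hM' hM₂'⟩

theorem HSubstL.comp {L L' L'' : Cls}
    (h₂ : HSubstN N₀ m α₀ N₂ N₂') (h : HSubstL N₂ j α₂ L L')
    (h' : HSubstL N₀ (m + j + 1) α₀ L L'') :
    ∃ M, HSubstL N₀ (m + j) α₀ L' M ∧ HSubstL N₂' j α₂ L'' M := by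
  induction L generalizing L' L'' j with
  | sort => cases h; cases h'; exact ⟨_, .sort, .sort⟩
  | pi S A L ih =>
    cases h with | pi hS hA hL => cases h' with | pi hS' hA' hL' =>
    obtain ⟨_, hM, hM'⟩ := hS.comp h₂ hS'
    obtain ⟨_, hM₁, hM₁'⟩ := hA.comp h₂ hA'
    obtain ⟨_, hM₂, hM₂'⟩ := ih hL hL'
    exact ⟨_, .pi hM hM₁ hM₂, .pi hM' hM₁' hM₂'⟩
  | top => cases h; cases h'; exact ⟨_, .top, .top⟩
  | inter L₁ L₂ ih₁ ih₂ =>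
    cases h with | inter hS hT => cases h' with | inter hS' hT' =>
    obtain ⟨_, hM, hM'⟩ := ih₁ hS hS'
    obtain ⟨_, hM₂, hM₂'⟩ := ih₂ hT hT'
    exact ⟨_, .inter hM hM₂, .inter hM' hM₂'⟩

end Comp

theorem HSubstP.head_eq {N₀ : Nrm} {k : ℕ} {α : STy} {P P' : ATy} (h : HSubstP N₀ k α P P') :
    P'.head = P.head := by
  induction h with
  | const => rfl
  | app _ _ ih => exact ih

theorem HSubstA.simple_eq {N₀ : Nrm} {k : ℕ} {α : STy} {A A' : Ty} (h : HSubstA N₀ k α A A') :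
    A'.simple = A.simple := by
  induction h with
  | atm h => exact congrArg STy.base h.head_eq
  | pi _ _ ih₁ ih₂ => exact congrArg₂ STy.arrow ih₁ ih₂

/-! ### Closed signatures -/

/-- The classifier in an LF declaration is closed: it is fixed by all renamings of variables. -/
def LFDecl.Closed : LFDecl → Prop
  | .ty _ K => ∀ ρ, K.ren ρ = K
  | .tm _ A => ∀ ρ, A.ren ρ = A

/-- The classifier in an LFR declaration is closed: it is fixed by all renamings of variables. -/
def Decl.Closed : Decl → Prop
  | .ty _ K => ∀ ρ, K.ren ρ = K
  | .tm _ A => ∀ ρ, A.ren ρ = A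
  | .srt _ _ L => ∀ ρ, L.ren ρ = L
  | .sub _ _ => True
  | .tmSrt _ S => ∀ ρ, S.ren ρ = S

/-- All classifiers declared in an LF signature are closed. -/
def LFSigClosed (Sg : LFSig) : Prop := ∀ d ∈ Sg, d.Closed

/-- All classifiers declared in an LFR signature are closed. -/
def SigClosed (Sg : Sig) : Prop := ∀ d ∈ Sg, d.Closed

theorem SigClosed.erase {Sg : Sig} (hSg : SigClosed Sg) : LFSigClosed (Sig.erase Sg) := by
  intro d' h
  obtain ⟨d, hd, h⟩ := List.mem_filterMap.1 h
  cases d <;> cases h <;> exact hSg _ hd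

section Closed

variable {N₀ : Nrm} {k : ℕ} {α : STy}

theorem LFSigClosed.hsubstA_tm {Sg : LFSig} (hSg : LFSigClosed Sg) {c : TmConst} {A : Ty}
    (h : LFDecl.tm c A ∈ Sg) : HSubstA N₀ k α A A := by
  have hA : ∀ ρ, A.ren ρ = A := hSg _ h
  simpa only [hA] using HSubstA.ren_skip k A

theorem LFSigClosed.hsubstK_ty {Sg : LFSig} (hSg : LFSigClosed Sg) {a : TyConst} {K : Kind}
    (h : LFDecl.ty a K ∈ Sg) : HSubstK N₀ k α K K := by
  have hK : ∀ ρ, K.ren ρ = K := hSg _ h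
  simpa only [hK] using HSubstK.ren_skip k K

theorem SigClosed.hsubstS_tmSrt {Sg : Sig} (hSg : SigClosed Sg) {c : TmConst} {S : Srt}
    (h : Decl.tmSrt c S ∈ Sg) : HSubstS N₀ k α S S := by
  have hS : ∀ ρ, S.ren ρ = S := hSg _ h
  simpa only [hS] using HSubstS.ren_skip k S

theorem SigClosed.hsubstL_srt {Sg : Sig} (hSg : SigClosed Sg) {s : SrtConst} {a : TyConst}
    {L : Cls} (h : Decl.srt s a L ∈ Sg) : HSubstL N₀ k α L L := by
  have hL : ∀ ρ, L.ren ρ = L := hSg _ h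
  simpa only [hL] using HSubstL.ren_skip k L

end Closed

/-! ### Weakening and substitution in canonical LF -/

/-- The renaming `ρ` leads from the LF context `Γ` to the LF context `Δ`. -/
def LFRen (ρ : ℕ → ℕ) (Γ Δ : LFCtx) : Prop :=
  ∀ ⦃i : ℕ⦄ ⦃A : Ty⦄, Γ[i]? = some A →
    ∃ B, Δ[ρ i]? = some B ∧ B.shift (ρ i + 1) = (A.shift (i + 1)).ren ρ

theorem LFRen.up {ρ : ℕ → ℕ} {Γ Δ : LFCtx} (h : LFRen ρ Γ Δ) (A : Ty) :
    LFRen (upRen ρ) (A :: Γ) (A.ren ρ :: Δ) := by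
  rintro (_ | i) B hi
  · cases hi
    exact ⟨_, rfl, (Ty.shift_one_ren ρ A).symm⟩
  · obtain ⟨C, hC, hC'⟩ := h hi
    refine ⟨C, hC, ?_⟩
    rw [upRen, ← Ty.shift_shift _ 1, hC', ← Ty.shift_one_ren, Ty.shift_shift]

theorem LFRen.succ (A : Ty) (Γ : LFCtx) : LFRen (· + 1) Γ (A :: Γ) :=
  fun i B hi => ⟨B, hi, (Ty.shift_shift (i + 1) 1 B).symm⟩

mutual
theorem LFSynth.ren {Sg : LFSig} (hSg : LFSigClosed Sg) {ρ : ℕ → ℕ} {Γ Δ : LFCtx} (hr : LFRen ρ Γ Δ)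
    {R : Atm} {A : Ty} :
    LFSynth Sg Γ R A → LFSynth Sg Δ (R.ren ρ) (A.ren ρ)
  | .const h => by rw [show A.ren ρ = A from hSg _ h ρ]; exact .const h
  | .var h => by
    obtain ⟨B, hB, hB'⟩ := hr h
    rw [← hB']
    exact .var hB
  | .app h₁ h₂ h₃ =>
    .app (h₁.ren hSg hr) (h₂.ren hSg hr) (by rw [Ty.simple_ren]; exact h₃.ren (.zero _ ρ))
theorem LFCheck.ren {Sg : LFSig} (hSg : LFSigClosed Sg) {ρ : ℕ → ℕ} {Γ Δ : LFCtx} (hr : LFRen ρ Γ Δ)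
    {N : Nrm} {A : Ty} :
    LFCheck Sg Γ N A → LFCheck Sg Δ (N.ren ρ) (A.ren ρ)
  | .atm h => .atm (h.ren hSg hr)
  | .lam h => .lam (h.ren hSg (hr.up _))
end

/-- `LFCtxSub Sg N₀ Γ Γ' k α₀`: the LF context `Γ'` results from `Γ` by the hereditary substitution
of `N₀` for its variable `k`, whose simple type is `α₀`. -/
inductive LFCtxSub (Sg : LFSig) (N₀ : Nrm) : LFCtx → LFCtx → ℕ → STy → Prop where
  | here {Γ : LFCtx} {A₀ : Ty} :
      LFCheck Sg Γ N₀ A₀ → LFCtxSub Sg N₀ (A₀ :: Γ) Γ 0 A₀.simple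
  | there {Γ Γ' : LFCtx} {k : ℕ} {α₀ : STy} {A A' : Ty} :
      LFCtxSub Sg N₀ Γ Γ' k α₀ → HSubstA N₀ k α₀ A A' →
      LFCtxSub Sg N₀ (A :: Γ) (A' :: Γ') (k + 1) α₀

theorem HSubstA.shift {N₀ : Nrm} {k : ℕ} {α : STy} {n m : ℕ} {A A' : Ty}
    (h : HSubstA N₀ k α (A.shift n) (A'.shift m)) :
    HSubstA N₀ (k + 1) α (A.shift (n + 1)) (A'.shift (m + 1)) := by
  rw [← Ty.shift_shift, ← Ty.shift_shift]
  exact h.ren (.add N₀ k 1)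

theorem LFCtxSub.lookup_target {Sg : LFSig} (hSg : LFSigClosed Sg) {N₀ : Nrm} {Γ Γ' : LFCtx} {k : ℕ}
    {α₀ : STy} {A : Ty} (hs : LFCtxSub Sg N₀ Γ Γ' k α₀) (hA : Γ[k]? = some A) :
    ∃ A', HSubstA N₀ k α₀ (A.shift (k + 1)) A' ∧ A'.simple = α₀ ∧
      LFCheck Sg Γ' (N₀.shift k) A' := by
  induction hs with
  | here h =>
    cases hA
    exact ⟨A, .ren_skip 0 A, rfl, N₀.shift_zero.symm ▸ h⟩
  | @there _ _ k _ _ _ _ _ ih =>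
    obtain ⟨A', hA', hα, hN₀⟩ := ih hA
    refine ⟨A'.shift 1, ?_, (Ty.simple_ren _ A').trans hα, ?_⟩
    · rw [← Ty.shift_shift]
      exact hA'.ren (.add N₀ k 1)
    · rw [← Nrm.shift_shift]
      exact hN₀.ren hSg (.succ _ _)

theorem LFCtxSub.lookup_skip {Sg : LFSig} {N₀ : Nrm} {Γ Γ' : LFCtx} {k i : ℕ} {α₀ : STy} {A : Ty}
    (hs : LFCtxSub Sg N₀ Γ Γ' k α₀) (hA : Γ[skip k i]? = some A) :
    ∃ A', Γ'[i]? = some A' ∧ HSubstA N₀ k α₀ (A.shift (skip k i + 1)) (A'.shift (i + 1)) := by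
  induction hs generalizing i with
  | here => exact ⟨A, hA, .shift_succ (i + 1) A⟩
  | @there _ _ k _ _ A₁' _ h ih =>
    rcases i with _ | i
    · cases hA
      exact ⟨A₁', rfl, h.ren (.add N₀ k 1)⟩
    · rw [skip_add k 1 i] at hA ⊢
      obtain ⟨A', hA', h⟩ := ih hA
      exact ⟨A', hA', h.shift⟩

/-- Hereditary substitution at the simple type `α₀` is total on, and preserves the typing of, the
terms of canonical LF. -/
def LFAdmissible (Sg : LFSig) (α₀ : STy) : Prop :=
  ∀ ⦃N₀ : Nrm⦄ ⦃Γ Γ' : LFCtx⦄ ⦃k : ℕ⦄, LFCtxSub Sg N₀ Γ Γ' k α₀ →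
    ∀ ⦃N : Nrm⦄ ⦃A A' : Ty⦄, LFCheck Sg Γ N A → HSubstA N₀ k α₀ A A' →
      ∃ N', HSubstN N₀ k α₀ N N' ∧ LFCheck Sg Γ' N' A'

mutual
theorem LFSynth.hsubst_of_lt {Sg : LFSig} (hSg : LFSigClosed Sg) {N₀ : Nrm} {Γ Γ' : LFCtx} {k : ℕ}
    {α₀ : STy} (ih : ∀ β, sizeOf β < sizeOf α₀ → LFAdmissible Sg β)
    (hs : LFCtxSub Sg N₀ Γ Γ' k α₀) {R : Atm} {A : Ty} :
    LFSynth Sg Γ R A → ∃ A', HSubstA N₀ k α₀ A A' ∧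
      ((∃ R', HSubstRR N₀ k α₀ R R' ∧ LFSynth Sg Γ' R' A') ∨
        ∃ N', HSubstRN N₀ k α₀ R N' A'.simple ∧ LFCheck Sg Γ' N' A')
  | .const h => ⟨_, hSg.hsubstA_tm h, .inl ⟨_, .const, .const h⟩⟩
  | .var (i := i) h => by
    obtain rfl | ⟨j, rfl⟩ := eq_or_exists_eq_skip k i
    · obtain ⟨A', hA', rfl, hN₀⟩ := hs.lookup_target hSg h
      exact ⟨A', hA', .inr ⟨_, .var, hN₀⟩⟩
    · obtain ⟨A', h', hA'⟩ := hs.lookup_skip h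
      exact ⟨_, hA', .inl ⟨_, .var_skip k j, .var h'⟩⟩
  | .app h₁ h₂ h₃ => by
    obtain ⟨_, ⟨⟩ | ⟨hA₂, hA⟩, hR⟩ := h₁.hsubst_of_lt hSg ih hs
    obtain ⟨N₂', hN₂, hN₂'⟩ := h₂.hsubst_of_lt hSg ih hs hA₂
    obtain ⟨A', hA', hA''⟩ := h₃.comp hN₂ hA
    rw [← hA₂.simple_eq] at hA''
    refine ⟨A', hA', ?_⟩
    obtain ⟨R', hR, hR'⟩ | ⟨_, hR, ⟨⟩ | ⟨hN⟩⟩ := hR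
    · exact .inl ⟨_, .app hR hN₂, .app hR' hN₂' hA''⟩
    · have hle := hR.sizeOf_le
      simp only [Ty.simple, STy.arrow.sizeOf_spec] at hle
      obtain ⟨N', hN', hN''⟩ := ih _ (by omega) (.here hN₂') hN hA''
      exact .inr ⟨N', by rw [hA''.simple_eq]; exact .beta hR hN₂ hN', hN''⟩
theorem LFCheck.hsubst_of_lt {Sg : LFSig} (hSg : LFSigClosed Sg) {N₀ : Nrm} {Γ Γ' : LFCtx} {k : ℕ}
    {α₀ : STy} (ih : ∀ β, sizeOf β < sizeOf α₀ → LFAdmissible Sg β)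
    (hs : LFCtxSub Sg N₀ Γ Γ' k α₀) {N : Nrm} {A A' : Ty} :
    LFCheck Sg Γ N A → HSubstA N₀ k α₀ A A' →
      ∃ N', HSubstN N₀ k α₀ N N' ∧ LFCheck Sg Γ' N' A'
  | .atm h, hA => by
    obtain ⟨A'', hA', hR⟩ := h.hsubst_of_lt hSg ih hs
    cases hA.unique hA'
    cases hA
    obtain ⟨R', hR, hR'⟩ | ⟨_, hR, ⟨hR'⟩⟩ := hR
    · exact ⟨_, .atm hR, .atm hR'⟩
    · exact ⟨_, .atmNorm hR, .atm hR'⟩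
  | .lam h, .pi hA hB => by
    obtain ⟨N', hN, hN'⟩ := h.hsubst_of_lt hSg ih (hs.there hA) hB
    exact ⟨_, .lam hN, .lam hN'⟩
end

theorem lfAdmissible {Sg : LFSig} (hSg : LFSigClosed Sg) (α₀ : STy) :
    LFAdmissible Sg α₀ :=
  fun _ _ _ _ hs _ _ _ h hA => h.hsubst_of_lt hSg (fun β _ => lfAdmissible hSg β) hs hA
  termination_by sizeOf α₀

section LFSubst

variable {Sg : LFSig} {N₀ : Nrm} {Γ Γ' : LFCtx} {k : ℕ} {α₀ : STy}

theorem LFSynth.hsubst (hSg : LFSigClosed Sg) (hs : LFCtxSub Sg N₀ Γ Γ' k α₀)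
    {R : Atm} {A : Ty} (h : LFSynth Sg Γ R A) : ∃ A', HSubstA N₀ k α₀ A A' ∧
      ((∃ R', HSubstRR N₀ k α₀ R R' ∧ LFSynth Sg Γ' R' A') ∨
        ∃ N', HSubstRN N₀ k α₀ R N' A'.simple ∧ LFCheck Sg Γ' N' A') :=
  h.hsubst_of_lt hSg (fun β _ => lfAdmissible hSg β) hs

theorem LFSynthKind.hsubst (hSg : LFSigClosed Sg) (hs : LFCtxSub Sg N₀ Γ Γ' k α₀)
    {P : ATy} {K : Kind} (h : LFSynthKind Sg Γ P K) :
    ∃ P' K', HSubstP N₀ k α₀ P P' ∧ HSubstK N₀ k α₀ K K' ∧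
      LFSynthKind Sg Γ' P' K' := by
  induction P generalizing K with
  | const a => cases h with | const h => exact ⟨_, _, .const, hSg.hsubstK_ty h, .const h⟩
  | app P N ih =>
    cases h with | app h₁ h₂ h₃ =>
    obtain ⟨P', _, hP, ⟨⟩ | ⟨hA, hK⟩, hP'⟩ := ih h₁
    obtain ⟨N', hN, hN'⟩ := lfAdmissible hSg α₀ hs h₂ hA
    obtain ⟨K', hK', hK''⟩ := h₃.comp hN hK
    rw [← hA.simple_eq] at hK''
    exact ⟨_, K', .app hP hN, hK', .app hP' hN' hK''⟩

theorem LFTyWf.hsubst (hSg : LFSigClosed Sg) (hs : LFCtxSub Sg N₀ Γ Γ' k α₀)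
    {A : Ty} (h : LFTyWf Sg Γ A) :
    ∃ A', HSubstA N₀ k α₀ A A' ∧ LFTyWf Sg Γ' A' := by
  induction A generalizing Γ Γ' k with
  | atm P =>
    cases h with | atm h =>
    obtain ⟨P', _, hP, ⟨⟩, hP'⟩ := h.hsubst hSg hs
    exact ⟨_, .atm hP, .atm hP'⟩
  | pi A₁ A₂ ih₁ ih₂ =>
    cases h with | pi h₁ h₂ =>
    obtain ⟨A₁', hA₁, hA₁'⟩ := ih₁ hs h₁
    obtain ⟨A₂', hA₂, hA₂'⟩ := ih₂ (hs.there hA₁) h₂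
    exact ⟨_, .pi hA₁ hA₂, .pi hA₁' hA₂'⟩

theorem LFKindWf.hsubst (hSg : LFSigClosed Sg) (hs : LFCtxSub Sg N₀ Γ Γ' k α₀)
    {K : Kind} (h : LFKindWf Sg Γ K) :
    ∃ K', HSubstK N₀ k α₀ K K' ∧ LFKindWf Sg Γ' K' := by
  induction K generalizing Γ Γ' k with
  | type => exact ⟨_, .type, .type⟩
  | pi A K ih =>
    cases h with | pi h₁ h₂ =>
    obtain ⟨A', hA, hA'⟩ := h₁.hsubst hSg hs
    obtain ⟨K', hK, hK'⟩ := ih (hs.there hA) h₂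
    exact ⟨_, .pi hA hK, .pi hA' hK'⟩

end LFSubst

/-! ### Weakening of sort checking -/

/-- The renaming `ρ` leads from the LFR context `Γ` to the LFR context `Δ`. -/
def CtxRen (ρ : ℕ → ℕ) (Γ Δ : Ctx) : Prop :=
  ∀ ⦃i : ℕ⦄ ⦃S : Srt⦄ ⦃A : Ty⦄, Γ[i]? = some (S, A) →
    ∃ T B, Δ[ρ i]? = some (T, B) ∧ T.shift (ρ i + 1) = (S.shift (i + 1)).ren ρ

theorem CtxRen.up {ρ : ℕ → ℕ} {Γ Δ : Ctx} (h : CtxRen ρ Γ Δ) (S : Srt) (A : Ty) :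
    CtxRen (upRen ρ) ((S, A) :: Γ) ((S.ren ρ, A.ren ρ) :: Δ) := by
  rintro (_ | i) T B hi
  · cases hi
    exact ⟨_, _, rfl, (Srt.shift_one_ren ρ S).symm⟩
  · obtain ⟨T', B', hT', h'⟩ := h hi
    refine ⟨T', B', hT', ?_⟩
    rw [upRen, ← Srt.shift_shift _ 1, h', ← Srt.shift_one_ren, Srt.shift_shift]

theorem CtxRen.succ (S : Srt) (A : Ty) (Γ : Ctx) : CtxRen (· + 1) Γ ((S, A) :: Γ) :=
  fun i T B hi => ⟨T, B, hi, (Srt.shift_shift (i + 1) 1 T).symm⟩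

theorem SubStep.ren {Sg : Sig} (ρ : ℕ → ℕ) {Q Q' : ASrt} (h : SubStep Sg Q Q') :
    SubStep Sg (Q.ren ρ) (Q'.ren ρ) := by
  induction h with
  | decl h => exact .decl h
  | app _ ih => exact .app ih

theorem Subsort.ren {Sg : Sig} (ρ : ℕ → ℕ) {Q Q' : ASrt} (h : Subsort Sg Q Q') :
    Subsort Sg (Q.ren ρ) (Q'.ren ρ) := by
  induction h with
  | refl => exact .refl
  | step h _ ih => exact .step (h.ren ρ) ih

mutual
theorem Synth.ren {Sg : Sig} (hSg : SigClosed Sg) {ρ : ℕ → ℕ} {Γ Δ : Ctx} (hr : CtxRen ρ Γ Δ)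
    {R : Atm} {S : Srt} : Synth Sg Γ R S → Synth Sg Δ (R.ren ρ) (S.ren ρ)
  | .const h => by rw [show S.ren ρ = S from hSg _ h ρ]; exact .const h
  | .var h => by
    obtain ⟨T, B, hT, hT'⟩ := hr h
    rw [← hT']
    exact .var hT
  | .app h₁ h₂ h₃ =>
    .app (h₁.ren hSg hr) (h₂.ren hSg hr) (by rw [Ty.simple_ren]; exact h₃.ren (.zero _ ρ))
  | .interE₁ h => .interE₁ (h.ren hSg hr)
  | .interE₂ h => .interE₂ (h.ren hSg hr)
theorem Check.ren {Sg : Sig} (hSg : SigClosed Sg) {ρ : ℕ → ℕ} {Γ Δ : Ctx} (hr : CtxRen ρ Γ Δ)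
    {N : Nrm} {S : Srt} : Check Sg Γ N S → Check Sg Δ (N.ren ρ) (S.ren ρ)
  | .switch h h' => .switch (h.ren hSg hr) (h'.ren ρ)
  | .lam h => .lam (h.ren hSg (hr.up _ _))
  | .top => .top
  | .inter h₁ h₂ => .inter (h₁.ren hSg hr) (h₂.ren hSg hr)
end

/-! ### Substitution for sorts -/

theorem Subsort.trans {Sg : Sig} {Q₁ Q₂ Q₃ : ASrt} (h : Subsort Sg Q₁ Q₂)
    (h' : Subsort Sg Q₂ Q₃) : Subsort Sg Q₁ Q₃ := by
  induction h with
  | refl => exact h'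
  | step h _ ih => exact .step h (ih h')

theorem SubStep.hsubst {Sg : Sig} {N₀ : Nrm} {k : ℕ} {α₀ : STy} {Q₁ Q₂ Q₁' : ASrt}
    (h : SubStep Sg Q₁ Q₂) (h₁ : HSubstQ N₀ k α₀ Q₁ Q₁') :
    ∃ Q₂', HSubstQ N₀ k α₀ Q₂ Q₂' ∧ SubStep Sg Q₁' Q₂' := by
  induction h generalizing Q₁' with
  | decl h => cases h₁; exact ⟨_, .const, .decl h⟩
  | app _ ih =>
    cases h₁ with | app hQ hN =>
    obtain ⟨_, h, h'⟩ := ih hQ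
    exact ⟨_, .app h hN, .app h'⟩

theorem Subsort.hsubst {Sg : Sig} {N₀ : Nrm} {k : ℕ} {α₀ : STy} {Q₁ Q₂ Q₁' Q₂' : ASrt}
    (h : Subsort Sg Q₁ Q₂) (h₁ : HSubstQ N₀ k α₀ Q₁ Q₁') (h₂ : HSubstQ N₀ k α₀ Q₂ Q₂') :
    Subsort Sg Q₁' Q₂' := by
  induction h generalizing Q₁' with
  | refl => rw [h₁.unique h₂]; exact .refl
  | step h _ ih =>
    obtain ⟨_, h', h''⟩ := h.hsubst h₁
    exact .step h'' (ih h' h₂)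

/-- The sort `S` refines the simple type `α`: the simple types of the domains annotated in `S` are
those of `α`. The head constants of atomic sorts are not constrained. -/
inductive SRefines : Srt → STy → Prop where
  | atm {Q : ASrt} {a : TyConst} : SRefines (.atm Q) (.base a)
  | pi {S S' : Srt} {A : Ty} {β : STy} :
      SRefines S A.simple → SRefines S' β → SRefines (.pi S A S') (.arrow A.simple β)
  | top {α : STy} : SRefines .top α
  | inter {S₁ S₂ : Srt} {α : STy} :
      SRefines S₁ α → SRefines S₂ α → SRefines (.inter S₁ S₂) α

theorem SRefines.ren {S : Srt} {α : STy} (ρ : ℕ → ℕ) (h : SRefines S α) :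
    SRefines (S.ren ρ) α := by
  induction h generalizing ρ with
  | atm => exact .atm
  | @pi _ _ A _ _ _ ih₁ ih₂ =>
    rw [← Ty.simple_ren ρ A] at ih₁ ⊢
    exact .pi (ih₁ ρ) (ih₂ (upRen ρ))
  | top => exact .top
  | inter _ _ ih₁ ih₂ => exact .inter (ih₁ ρ) (ih₂ ρ)

theorem SRefines.hsubst {N₀ : Nrm} {k : ℕ} {α₀ β : STy} {S S' : Srt} (h : SRefines S β)
    (hS : HSubstS N₀ k α₀ S S') : SRefines S' β := by
  induction hS generalizing β with
  | atm => cases h; exact .atm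
  | pi _ hA _ ih₁ ih₂ =>
    cases h with | pi h₁ h₂ =>
    rw [← hA.simple_eq] at h₁ ⊢
    exact .pi (ih₁ h₁) (ih₂ h₂)
  | top => exact .top
  | inter _ _ ih₁ ih₂ => cases h with | inter h₁ h₂ => exact .inter (ih₁ h₁) (ih₂ h₂)

theorem Refines.srefines {Sg : Sig} {Γ : Ctx} {S : Srt} {A : Ty} (h : Refines Sg Γ S A) :
    SRefines S A.simple := by
  induction h with
  | atm => exact .atm
  | pi _ _ ih₁ ih₂ => exact .pi ih₁ ih₂
  | top => exact .top
  | inter _ _ ih₁ ih₂ => exact .inter ih₁ ih₂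

/-- `CtxSub Sg N₀ Γ Γ' k α₀`: the LFR context `Γ'` results from `Γ` by the hereditary substitution
of `N₀` for its variable `k`, whose simple type is `α₀`. -/
inductive CtxSub (Sg : Sig) (N₀ : Nrm) : Ctx → Ctx → ℕ → STy → Prop where
  | here {Γ : Ctx} {S₀ : Srt} {A₀ : Ty} :
      Check Sg Γ N₀ S₀ → SRefines S₀ A₀.simple → CtxSub Sg N₀ ((S₀, A₀) :: Γ) Γ 0 A₀.simple
  | there {Γ Γ' : Ctx} {k : ℕ} {α₀ : STy} {S S' : Srt} {A A' : Ty} :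
      CtxSub Sg N₀ Γ Γ' k α₀ → HSubstS N₀ k α₀ S S' → HSubstA N₀ k α₀ A A' →
      CtxSub Sg N₀ ((S, A) :: Γ) ((S', A') :: Γ') (k + 1) α₀

theorem CtxSub.lookup_target {Sg : Sig} (hSg : SigClosed Sg) {N₀ : Nrm} {Γ Γ' : Ctx} {k : ℕ}
    {α₀ : STy} {S : Srt} {A : Ty} (hs : CtxSub Sg N₀ Γ Γ' k α₀) (hS : Γ[k]? = some (S, A)) :
    ∃ S', HSubstS N₀ k α₀ (S.shift (k + 1)) S' ∧ SRefines S' α₀ ∧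
      Check Sg Γ' (N₀.shift k) S' := by
  induction hs with
  | here h hα =>
    cases hS
    exact ⟨S, .ren_skip 0 S, hα, N₀.shift_zero.symm ▸ h⟩
  | @there _ _ k _ _ _ _ _ _ _ _ ih =>
    obtain ⟨S', hS', hα, hN₀⟩ := ih hS
    refine ⟨S'.shift 1, ?_, hα.ren _, ?_⟩
    · rw [← Srt.shift_shift]
      exact hS'.ren (.add N₀ k 1)
    · rw [← Nrm.shift_shift]
      exact hN₀.ren hSg (.succ _ _ _)

theorem CtxSub.lookup_skip {Sg : Sig} {N₀ : Nrm} {Γ Γ' : Ctx} {k i : ℕ} {α₀ : STy} {S : Srt}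
    {A : Ty} (hs : CtxSub Sg N₀ Γ Γ' k α₀) (hS : Γ[skip k i]? = some (S, A)) :
    ∃ S' A', Γ'[i]? = some (S', A') ∧
      HSubstS N₀ k α₀ (S.shift (skip k i + 1)) (S'.shift (i + 1)) := by
  induction hs generalizing i with
  | here => exact ⟨S, A, hS, .shift_succ (i + 1) S⟩
  | @there _ _ k _ _ S₁' _ A₁' _ h _ ih =>
    rcases i with _ | i
    · cases hS
      exact ⟨S₁', A₁', rfl, h.ren (.add N₀ k 1)⟩
    · rw [skip_add k 1 i] at hS ⊢
      obtain ⟨S', A', hS', h⟩ := ih hS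
      refine ⟨S', A', hS', ?_⟩
      rw [← Srt.shift_shift, ← Srt.shift_shift (i + 1)]
      exact h.ren (.add N₀ k 1)

/-- Hereditary substitution at the simple type `α₀` preserves sort checking wherever it is
defined. -/
def SortAdmissible (Sg : Sig) (α₀ : STy) : Prop :=
  ∀ ⦃N₀ : Nrm⦄ ⦃Γ Γ' : Ctx⦄ ⦃k : ℕ⦄, CtxSub Sg N₀ Γ Γ' k α₀ →
    ∀ ⦃N N' : Nrm⦄ ⦃S S' : Srt⦄, Check Sg Γ N S → HSubstN N₀ k α₀ N N' →
      HSubstS N₀ k α₀ S S' → Check Sg Γ' N' S'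

mutual
theorem Synth.hsubstRR_of_lt {Sg : Sig} (hSg : SigClosed Sg) {N₀ : Nrm} {Γ Γ' : Ctx} {k : ℕ}
    {α₀ : STy} (ih : ∀ β, sizeOf β < sizeOf α₀ → SortAdmissible Sg β)
    (hs : CtxSub Sg N₀ Γ Γ' k α₀) {R R' : Atm} {S : Srt} :
    Synth Sg Γ R S → HSubstRR N₀ k α₀ R R' → ∃ S', HSubstS N₀ k α₀ S S' ∧ Synth Sg Γ' R' S'
  | .const h, .const => ⟨_, hSg.hsubstS_tmSrt h, .const h⟩
  | .var h, hR => by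
    obtain ⟨j, rfl, rfl⟩ := hR.exists_eq_skip
    obtain ⟨S', A', h', hS'⟩ := hs.lookup_skip h
    exact ⟨_, hS', .var h'⟩
  | .app h₁ h₂ h₃, .app hR hN => by
    obtain ⟨_, ⟨⟩ | ⟨hS₂, hA₂, hS⟩, hR'⟩ := h₁.hsubstRR_of_lt hSg ih hs hR
    obtain ⟨S', hS', hS''⟩ := h₃.comp hN hS
    rw [← hA₂.simple_eq] at hS''
    exact ⟨S', hS', .app hR' (h₂.hsubst_of_lt hSg ih hs hN hS₂) hS''⟩
  | .interE₁ h, hR => by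
    obtain ⟨_, ⟨⟩ | ⟨⟩ | ⟨⟩ | ⟨hS₁, _⟩, hR'⟩ := h.hsubstRR_of_lt hSg ih hs hR
    exact ⟨_, hS₁, .interE₁ hR'⟩
  | .interE₂ h, hR => by
    obtain ⟨_, ⟨⟩ | ⟨⟩ | ⟨⟩ | ⟨_, hS₂⟩, hR'⟩ := h.hsubstRR_of_lt hSg ih hs hR
    exact ⟨_, hS₂, .interE₂ hR'⟩
theorem Synth.hsubstRN_of_lt {Sg : Sig} (hSg : SigClosed Sg) {N₀ N' : Nrm} {Γ Γ' : Ctx} {k : ℕ}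
    {α₀ β : STy} (ih : ∀ β, sizeOf β < sizeOf α₀ → SortAdmissible Sg β)
    (hs : CtxSub Sg N₀ Γ Γ' k α₀) {R : Atm} {S : Srt} :
    Synth Sg Γ R S → HSubstRN N₀ k α₀ R N' β →
      ∃ S', HSubstS N₀ k α₀ S S' ∧ SRefines S' β ∧ Check Sg Γ' N' S'
  | .var h, .var => hs.lookup_target hSg h
  | .app h₁ h₂ h₃, .beta hR hN hN' => by
    obtain ⟨_, ⟨⟩ | ⟨hS₂, hA₂, hS⟩, ⟨⟩ | ⟨hα₂, hα⟩, ⟨⟩ | ⟨h⟩⟩ := h₁.hsubstRN_of_lt hSg ih hs hR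
    obtain ⟨S', hS', hS''⟩ := h₃.comp hN hS
    rw [← hA₂.simple_eq] at hS''
    have hle := hR.sizeOf_le
    simp only [STy.arrow.sizeOf_spec] at hle
    have h₂' := h₂.hsubst_of_lt hSg ih hs hN hS₂
    exact ⟨S', hS', hα.hsubst hS'', ih _ (by omega) (.here h₂' hα₂) h hN' hS''⟩
  | .interE₁ h, hR => by
    obtain ⟨_, ⟨⟩ | ⟨⟩ | ⟨⟩ | ⟨hS₁, _⟩, hα, h'⟩ := h.hsubstRN_of_lt hSg ih hs hR
    cases hα with | inter hα₁ _ => cases h' with | inter h₁ _ => exact ⟨_, hS₁, hα₁, h₁⟩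
  | .interE₂ h, hR => by
    obtain ⟨_, ⟨⟩ | ⟨⟩ | ⟨⟩ | ⟨_, hS₂⟩, hα, h'⟩ := h.hsubstRN_of_lt hSg ih hs hR
    cases hα with | inter _ hα₂ => cases h' with | inter _ h₂ => exact ⟨_, hS₂, hα₂, h₂⟩
theorem Check.hsubst_of_lt {Sg : Sig} (hSg : SigClosed Sg) {N₀ : Nrm} {Γ Γ' : Ctx} {k : ℕ}
    {α₀ : STy} (ih : ∀ β, sizeOf β < sizeOf α₀ → SortAdmissible Sg β)
    (hs : CtxSub Sg N₀ Γ Γ' k α₀) {N N' : Nrm} {S S' : Srt} :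
    Check Sg Γ N S → HSubstN N₀ k α₀ N N' → HSubstS N₀ k α₀ S S' → Check Sg Γ' N' S'
  | .switch h hle, .atm hR, .atm hQ => by
    obtain ⟨_, ⟨hQ'⟩, hR'⟩ := h.hsubstRR_of_lt hSg ih hs hR
    exact .switch hR' (hle.hsubst hQ' hQ)
  | .switch h hle, .atmNorm hR, .atm hQ => by
    obtain ⟨_, ⟨hQ'⟩, _, ⟨hR', hle'⟩⟩ := h.hsubstRN_of_lt hSg ih hs hR
    exact .switch hR' (hle'.trans (hle.hsubst hQ' hQ))
  | .lam h, .lam hN, .pi hS hA hS' => .lam (h.hsubst_of_lt hSg ih (hs.there hS hA) hN hS')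
  | .top, _, .top => .top
  | .inter h₁ h₂, hN, .inter hS₁ hS₂ =>
    .inter (h₁.hsubst_of_lt hSg ih hs hN hS₁) (h₂.hsubst_of_lt hSg ih hs hN hS₂)
end

theorem sortAdmissible {Sg : Sig} (hSg : SigClosed Sg) (α₀ : STy) : SortAdmissible Sg α₀ :=
  fun _ _ _ _ hs _ _ _ _ h hN hS =>
    h.hsubst_of_lt hSg (fun β _ => sortAdmissible hSg β) hs hN hS
  termination_by sizeOf α₀

section Subst

variable {Sg : Sig} {N₀ : Nrm} {Γ Γ' : Ctx} {k : ℕ} {α₀ : STy}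

theorem Synth.hsubstRR (hSg : SigClosed Sg) (hs : CtxSub Sg N₀ Γ Γ' k α₀) {R R' : Atm} {S : Srt}
    (h : Synth Sg Γ R S) (hR : HSubstRR N₀ k α₀ R R') :
    ∃ S', HSubstS N₀ k α₀ S S' ∧ Synth Sg Γ' R' S' :=
  h.hsubstRR_of_lt hSg (fun β _ => sortAdmissible hSg β) hs hR

theorem Synth.hsubstRN (hSg : SigClosed Sg) (hs : CtxSub Sg N₀ Γ Γ' k α₀) {R : Atm} {N' : Nrm}
    {β : STy} {S : Srt} (h : Synth Sg Γ R S) (hR : HSubstRN N₀ k α₀ R N' β) :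
    ∃ S', HSubstS N₀ k α₀ S S' ∧ Check Sg Γ' N' S' := by
  obtain ⟨S', hS', _, h'⟩ := h.hsubstRN_of_lt hSg (fun β _ => sortAdmissible hSg β) hs hR
  exact ⟨S', hS', h'⟩

theorem SynthCls.hsubst (hSg : SigClosed Sg) (hs : CtxSub Sg N₀ Γ Γ' k α₀) {Q : ASrt}
    {P P' : ATy} {L : Cls} (h : SynthCls Sg Γ Q P L) (hP : HSubstP N₀ k α₀ P P') :
    ∃ Q' L', HSubstQ N₀ k α₀ Q Q' ∧ HSubstL N₀ k α₀ L L' ∧ SynthCls Sg Γ' Q' P' L' := by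
  induction h generalizing P' with
  | const h => cases hP; exact ⟨_, _, .const, hSg.hsubstL_srt h, .const h⟩
  | app _ h₂ h₃ ih =>
    cases hP with | app hP hN =>
    obtain ⟨_, _, hQ, ⟨⟩ | ⟨hS, hA, hL⟩, hQ'⟩ := ih hP
    obtain ⟨_, hL', hL''⟩ := h₃.comp hN hL
    rw [← hA.simple_eq] at hL''
    exact ⟨_, _, .app hQ hN, hL', .app hQ' (sortAdmissible hSg α₀ hs h₂ hN hS) hL''⟩
  | interE₁ _ ih =>
    obtain ⟨_, _, hQ, ⟨⟩ | ⟨⟩ | ⟨⟩ | ⟨hL₁, _⟩, hQ'⟩ := ih hP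
    exact ⟨_, _, hQ, hL₁, .interE₁ hQ'⟩
  | interE₂ _ ih =>
    obtain ⟨_, _, hQ, ⟨⟩ | ⟨⟩ | ⟨⟩ | ⟨_, hL₂⟩, hQ'⟩ := ih hP
    exact ⟨_, _, hQ, hL₂, .interE₂ hQ'⟩

theorem Refines.hsubst (hSg : SigClosed Sg) (hs : CtxSub Sg N₀ Γ Γ' k α₀) {S : Srt} {A A' : Ty}
    (h : Refines Sg Γ S A) (hA : HSubstA N₀ k α₀ A A') :
    ∃ S', HSubstS N₀ k α₀ S S' ∧ Refines Sg Γ' S' A' := by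
  induction h generalizing Γ' k A' with
  | atm h =>
    cases hA with | atm hP =>
    obtain ⟨_, _, hQ, ⟨⟩, hQ'⟩ := h.hsubst hSg hs hP
    exact ⟨_, .atm hQ, .atm hQ'⟩
  | pi _ _ ih₁ ih₂ =>
    cases hA with | pi hA₁ hA₂ =>
    obtain ⟨_, hS₁, hS₁'⟩ := ih₁ hs hA₁
    obtain ⟨_, hS₂, hS₂'⟩ := ih₂ (hs.there hS₁ hA₁) hA₂
    exact ⟨_, .pi hS₁ hA₁ hS₂, .pi hS₁' hS₂'⟩
  | top => exact ⟨_, .top, .top⟩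
  | inter _ _ ih₁ ih₂ =>
    obtain ⟨_, hS₁, hS₁'⟩ := ih₁ hs hA
    obtain ⟨_, hS₂, hS₂'⟩ := ih₂ hs hA
    exact ⟨_, .inter hS₁ hS₂, .inter hS₁' hS₂'⟩

theorem RefinesCls.hsubst (hSg : SigClosed Sg) (hs : CtxSub Sg N₀ Γ Γ' k α₀) {L : Cls}
    {K K' : Kind} (h : RefinesCls Sg Γ L K) (hK : HSubstK N₀ k α₀ K K') :
    ∃ L', HSubstL N₀ k α₀ L L' ∧ RefinesCls Sg Γ' L' K' := by
  induction h generalizing Γ' k K' with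
  | sort => cases hK; exact ⟨_, .sort, .sort⟩
  | pi hS _ ih =>
    cases hK with | pi hA hK =>
    obtain ⟨_, hS, hS'⟩ := hS.hsubst hSg hs hA
    obtain ⟨_, hL, hL'⟩ := ih (hs.there hS hA) hK
    exact ⟨_, .pi hS hA hL, .pi hS' hL'⟩
  | top => exact ⟨_, .top, .top⟩
  | inter _ _ ih₁ ih₂ =>
    obtain ⟨_, hL₁, hL₁'⟩ := ih₁ hs hK
    obtain ⟨_, hL₂, hL₂'⟩ := ih₂ hs hK
    exact ⟨_, .inter hL₁ hL₂, .inter hL₁' hL₂'⟩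

end Subst

/-! ### Well-formed signatures are closed -/

mutual
theorem LFSynth.ren_eq_self {Sg : LFSig} {Γ : LFCtx} {ρ : ℕ → ℕ} (hρ : ∀ i < Γ.length, ρ i = i)
    {R : Atm} {A : Ty} : LFSynth Sg Γ R A → R.ren ρ = R
  | .const _ => rfl
  | .var h => congrArg Atm.var (hρ _ (List.getElem?_eq_some_iff.1 h).1)
  | .app h₁ h₂ _ => congrArg₂ Atm.app (h₁.ren_eq_self hρ) (h₂.ren_eq_self hρ)
theorem LFCheck.ren_eq_self {Sg : LFSig} {Γ : LFCtx} {ρ : ℕ → ℕ} (hρ : ∀ i < Γ.length, ρ i = i)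
    {N : Nrm} {A : Ty} : LFCheck Sg Γ N A → N.ren ρ = N
  | .atm h => congrArg Nrm.atm (h.ren_eq_self hρ)
  | .lam h => congrArg Nrm.lam (h.ren_eq_self (Γ := _ :: Γ) (upRen_eq_self hρ))
end

section RenEqSelf

variable {Γ : LFCtx} {ρ : ℕ → ℕ}

theorem LFSynthKind.ren_eq_self {Sg : LFSig} (hρ : ∀ i < Γ.length, ρ i = i) {P : ATy} {K : Kind}
    (h : LFSynthKind Sg Γ P K) : P.ren ρ = P := by
  induction h with
  | const => rfl
  | app _ h _ ih => exact congrArg₂ ATy.app ih (h.ren_eq_self hρ)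

theorem LFTyWf.ren_eq_self {Sg : LFSig} (hρ : ∀ i < Γ.length, ρ i = i) {A : Ty}
    (h : LFTyWf Sg Γ A) : A.ren ρ = A := by
  induction h generalizing ρ with
  | atm h => exact congrArg Ty.atm (h.ren_eq_self hρ)
  | pi _ _ ih₁ ih₂ => exact congrArg₂ Ty.pi (ih₁ hρ) (ih₂ (upRen_eq_self hρ))

theorem LFKindWf.ren_eq_self {Sg : LFSig} (hρ : ∀ i < Γ.length, ρ i = i) {K : Kind}
    (h : LFKindWf Sg Γ K) : K.ren ρ = K := by
  induction h generalizing ρ with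
  | type => rfl
  | pi h _ ih => exact congrArg₂ Kind.pi (h.ren_eq_self hρ) (ih (upRen_eq_self hρ))

end RenEqSelf

section RefinesRen

variable {Sg : Sig} {Γ : Ctx} {ρ : ℕ → ℕ}

theorem SynthCls.ren_eq_self {Q : ASrt} {P : ATy} {L : Cls} (h : SynthCls Sg Γ Q P L)
    (hP : P.ren ρ = P) : Q.ren ρ = Q := by
  induction h with
  | const => rfl
  | app _ _ _ ih => injection hP with hP hN; exact congrArg₂ ASrt.app (ih hP) hN
  | interE₁ _ ih => exact ih hP
  | interE₂ _ ih => exact ih hP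

theorem Refines.ren_eq_self {S : Srt} {A : Ty} (h : Refines Sg Γ S A) (hA : A.ren ρ = A) :
    S.ren ρ = S := by
  induction h generalizing ρ with
  | atm h => injection hA with hP; exact congrArg Srt.atm (h.ren_eq_self hP)
  | pi _ _ ih₁ ih₂ => injection hA with hA₁ hA₂; rw [Srt.ren, ih₁ hA₁, hA₁, ih₂ hA₂]
  | top => rfl
  | inter _ _ ih₁ ih₂ => exact congrArg₂ Srt.inter (ih₁ hA) (ih₂ hA)

theorem RefinesCls.ren_eq_self {L : Cls} {K : Kind} (h : RefinesCls Sg Γ L K)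
    (hK : K.ren ρ = K) : L.ren ρ = L := by
  induction h generalizing ρ with
  | sort => rfl
  | pi h _ ih => injection hK with hA hK; rw [Cls.ren, h.ren_eq_self hA, hA, ih hK]
  | top => rfl
  | inter _ _ ih₁ ih₂ => exact congrArg₂ Cls.inter (ih₁ hK) (ih₂ hK)

end RefinesRen

theorem SigWf.closed {Sg : Sig} (h : SigWf Sg) : SigClosed Sg := by
  induction h with
  | nil => exact List.forall_mem_nil _
  | ty _ hK _ ih =>
    exact List.forall_mem_cons.2 ⟨fun _ => hK.ren_eq_self (by simp), ih⟩
  | tm _ hA _ ih =>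
    exact List.forall_mem_cons.2 ⟨fun _ => hA.ren_eq_self (by simp), ih⟩
  | srt _ ha hL _ ih => exact List.forall_mem_cons.2 ⟨fun ρ => hL.ren_eq_self (ih _ ha ρ), ih⟩
  | tmSrt _ hc hS _ ih => exact List.forall_mem_cons.2 ⟨fun ρ => hS.ren_eq_self (ih _ hc ρ), ih⟩
  | sub _ _ _ ih => exact List.forall_mem_cons.2 ⟨trivial, ih⟩

/-! ### Substitution into contexts -/

theorem exists_hsubstCtx {Sg : Sig} (hSg : SigClosed Sg) {ΓL ΓR : Ctx} {N₀ : Nrm} {S₀ : Srt}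
    {A₀ : Ty} (hN₀ : Check Sg ΓL N₀ S₀)
    (hN₀' : LFCheck (Sig.erase Sg) (Ctx.erase ΓL) N₀ A₀)
    (hΓ : CtxWf Sg (ΓR ++ (S₀, A₀) :: ΓL))
    (hΓ' : LFCtxWf (Sig.erase Sg) (Ctx.erase (ΓR ++ (S₀, A₀) :: ΓL))) :
    ∃ ΓR', HSubstCtx N₀ A₀.simple ΓR ΓR' ∧ CtxWf Sg (ΓR' ++ ΓL) ∧
      LFCtxWf (Sig.erase Sg) (Ctx.erase (ΓR' ++ ΓL)) ∧
      CtxSub Sg N₀ (ΓR ++ (S₀, A₀) :: ΓL) (ΓR' ++ ΓL) ΓR.length A₀.simple ∧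
      LFCtxSub (Sig.erase Sg) N₀ (Ctx.erase (ΓR ++ (S₀, A₀) :: ΓL)) (Ctx.erase (ΓR' ++ ΓL))
        ΓR.length A₀.simple := by
  induction ΓR with
  | nil =>
    cases hΓ with | cons hΓ hS =>
    cases hΓ' with | cons hΓ' hA =>
    exact ⟨[], .nil, hΓ, hΓ', .here hN₀ hS.srefines, .here hN₀'⟩
  | cons D ΓR ih =>
    cases hΓ with | cons hΓ hS =>
    cases hΓ' with | cons hΓ' hA =>
    obtain ⟨ΓR', hR, hwf, hwf', hs, hs'⟩ := ih hΓ hΓ'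
    obtain ⟨A', hA', hAwf⟩ := hA.hsubst hSg.erase hs'
    obtain ⟨S', hS', hSwf⟩ := hS.hsubst hSg hs hA'
    exact ⟨(S', A') :: ΓR', .cons hR hS' hA', .cons hwf hSwf, .cons hwf' hAwf,
      hs.there hS' hA', hs'.there hA'⟩

end LFR

open LFR in
theorem mainTheorem2_general
    (Sg : Sig) (hSg : SigClosed Sg)
    (ΓL ΓR : Ctx) (N₀ : Nrm) (S₀ : Srt) (A₀ : Ty)
    (hN₀ : Check Sg ΓL N₀ S₀)
    (hN₀' : LFCheck (Sig.erase Sg) (Ctx.erase ΓL) N₀ A₀)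
    (hΓ : CtxWf Sg (ΓR ++ (S₀, A₀) :: ΓL))
    (hΓ' : LFCtxWf (Sig.erase Sg) (Ctx.erase (ΓR ++ (S₀, A₀) :: ΓL))) :
    ∃ ΓR' : Ctx, HSubstCtx N₀ A₀.simple ΓR ΓR' ∧
      CtxWf Sg (ΓR' ++ ΓL) ∧
      LFCtxWf (Sig.erase Sg) (Ctx.erase (ΓR' ++ ΓL)) ∧
      (∀ (N : Nrm) (S : Srt) (A : Ty),
        Refines Sg (ΓR ++ (S₀, A₀) :: ΓL) S A →
        LFTyWf (Sig.erase Sg) (Ctx.erase (ΓR ++ (S₀, A₀) :: ΓL)) A →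
        Check Sg (ΓR ++ (S₀, A₀) :: ΓL) N S →
        LFCheck (Sig.erase Sg) (Ctx.erase (ΓR ++ (S₀, A₀) :: ΓL)) N A →
        ∃ (N' : Nrm) (S' : Srt) (A' : Ty),
          HSubstS N₀ ΓR.length A₀.simple S S' ∧
          HSubstA N₀ ΓR.length A₀.simple A A' ∧
          Refines Sg (ΓR' ++ ΓL) S' A' ∧
          LFTyWf (Sig.erase Sg) (Ctx.erase (ΓR' ++ ΓL)) A' ∧
          HSubstN N₀ ΓR.length A₀.simple N N' ∧
          Check Sg (ΓR' ++ ΓL) N' S' ∧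
          LFCheck (Sig.erase Sg) (Ctx.erase (ΓR' ++ ΓL)) N' A') ∧
      (∀ (R : Atm) (S : Srt) (A : Ty),
        Synth Sg (ΓR ++ (S₀, A₀) :: ΓL) R S →
        LFSynth (Sig.erase Sg) (Ctx.erase (ΓR ++ (S₀, A₀) :: ΓL)) R A →
        ∃ (S' : Srt) (A' : Ty),
          HSubstS N₀ ΓR.length A₀.simple S S' ∧
          HSubstA N₀ ΓR.length A₀.simple A A' ∧
          ((∃ R' : Atm, HSubstRR N₀ ΓR.length A₀.simple R R' ∧
              Synth Sg (ΓR' ++ ΓL) R' S' ∧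
              LFSynth (Sig.erase Sg) (Ctx.erase (ΓR' ++ ΓL)) R' A') ∨
            (∃ N' : Nrm, HSubstRN N₀ ΓR.length A₀.simple R N' A'.simple ∧
              Check Sg (ΓR' ++ ΓL) N' S' ∧
              LFCheck (Sig.erase Sg) (Ctx.erase (ΓR' ++ ΓL)) N' A'))) ∧
      (∀ (S : Srt) (A : Ty),
        Refines Sg (ΓR ++ (S₀, A₀) :: ΓL) S A →
        LFTyWf (Sig.erase Sg) (Ctx.erase (ΓR ++ (S₀, A₀) :: ΓL)) A →
        ∃ (S' : Srt) (A' : Ty),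
          HSubstS N₀ ΓR.length A₀.simple S S' ∧
          HSubstA N₀ ΓR.length A₀.simple A A' ∧
          Refines Sg (ΓR' ++ ΓL) S' A' ∧
          LFTyWf (Sig.erase Sg) (Ctx.erase (ΓR' ++ ΓL)) A') ∧
      (∀ (Q : ASrt) (P : ATy) (L : Cls) (K : Kind),
        SynthCls Sg (ΓR ++ (S₀, A₀) :: ΓL) Q P L →
        LFSynthKind (Sig.erase Sg) (Ctx.erase (ΓR ++ (S₀, A₀) :: ΓL)) P K →
        ∃ (Q' : ASrt) (P' : ATy) (L' : Cls) (K' : Kind),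
          HSubstQ N₀ ΓR.length A₀.simple Q Q' ∧
          HSubstP N₀ ΓR.length A₀.simple P P' ∧
          HSubstL N₀ ΓR.length A₀.simple L L' ∧
          HSubstK N₀ ΓR.length A₀.simple K K' ∧
          SynthCls Sg (ΓR' ++ ΓL) Q' P' L' ∧
          LFSynthKind (Sig.erase Sg) (Ctx.erase (ΓR' ++ ΓL)) P' K') ∧
      (∀ (L : Cls) (K : Kind),
        RefinesCls Sg (ΓR ++ (S₀, A₀) :: ΓL) L K →
        LFKindWf (Sig.erase Sg) (Ctx.erase (ΓR ++ (S₀, A₀) :: ΓL)) K →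
        ∃ (L' : Cls) (K' : Kind),
          HSubstL N₀ ΓR.length A₀.simple L L' ∧
          HSubstK N₀ ΓR.length A₀.simple K K' ∧
          RefinesCls Sg (ΓR' ++ ΓL) L' K' ∧
          LFKindWf (Sig.erase Sg) (Ctx.erase (ΓR' ++ ΓL)) K') := by
  obtain ⟨ΓR', hR, hwf, hwf', hs, hs'⟩ := exists_hsubstCtx hSg hN₀ hN₀' hΓ hΓ'
  refine ⟨ΓR', hR, hwf, hwf', ?_, ?_, ?_, ?_, ?_⟩
  · intro N S A hS hA hNS hNA
    obtain ⟨A', hA', hAwf⟩ := hA.hsubst hSg.erase hs'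
    obtain ⟨S', hS', hSwf⟩ := hS.hsubst hSg hs hA'
    obtain ⟨N', hN', hNA'⟩ := lfAdmissible hSg.erase _ hs' hNA hA'
    exact ⟨N', S', A', hS', hA', hSwf, hAwf, hN', sortAdmissible hSg _ hs hNS hN' hS', hNA'⟩
  · intro R S A hRS hRA
    obtain ⟨A', hA', ⟨R', hR', hRA'⟩ | ⟨N', hN', hNA'⟩⟩ := hRA.hsubst hSg.erase hs'
    · obtain ⟨S', hS', hRS'⟩ := hRS.hsubstRR hSg hs hR'
      exact ⟨S', A', hS', hA', .inl ⟨R', hR', hRS', hRA'⟩⟩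
    · obtain ⟨S', hS', hNS'⟩ := hRS.hsubstRN hSg hs hN'
      exact ⟨S', A', hS', hA', .inr ⟨N', hN', hNS', hNA'⟩⟩
  · intro S A hS hA
    obtain ⟨A', hA', hAwf⟩ := hA.hsubst hSg.erase hs'
    obtain ⟨S', hS', hSwf⟩ := hS.hsubst hSg hs hA'
    exact ⟨S', A', hS', hA', hSwf, hAwf⟩
  · intro Q P L K hQ hP
    obtain ⟨P', K', hP', hK', hPK⟩ := hP.hsubst hSg.erase hs'
    obtain ⟨Q', L', hQ', hL', hQL⟩ := hQ.hsubst hSg hs hP'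
    exact ⟨Q', P', L', K', hQ', hP', hL', hK', hQL, hPK⟩
  · intro L K hL hK
    obtain ⟨K', hK', hKwf⟩ := hK.hsubst hSg.erase hs'
    obtain ⟨L', hL', hLwf⟩ := hL.hsubst hSg hs hK'
    exact ⟨L', K', hL', hK', hLwf, hKwf⟩

open LFR in
theorem mainTheorem2
    (Sg : Sig) (hSg : SigWf Sg)
    (ΓL ΓR : Ctx) (N₀ : Nrm) (S₀ : Srt) (A₀ : Ty)
    (hN₀ : Check Sg ΓL N₀ S₀)
    (hN₀' : LFCheck (Sig.erase Sg) (Ctx.erase ΓL) N₀ A₀)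
    (hΓ : CtxWf Sg (ΓR ++ (S₀, A₀) :: ΓL))
    (hΓ' : LFCtxWf (Sig.erase Sg) (Ctx.erase (ΓR ++ (S₀, A₀) :: ΓL))) :
    -- contexts
    ∃ ΓR' : Ctx, HSubstCtx N₀ A₀.simple ΓR ΓR' ∧
      CtxWf Sg (ΓR' ++ ΓL) ∧
      LFCtxWf (Sig.erase Sg) (Ctx.erase (ΓR' ++ ΓL)) ∧
      -- normal terms
      (∀ (N : Nrm) (S : Srt) (A : Ty),
        Refines Sg (ΓR ++ (S₀, A₀) :: ΓL) S A →
        LFTyWf (Sig.erase Sg) (Ctx.erase (ΓR ++ (S₀, A₀) :: ΓL)) A →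
        Check Sg (ΓR ++ (S₀, A₀) :: ΓL) N S →
        LFCheck (Sig.erase Sg) (Ctx.erase (ΓR ++ (S₀, A₀) :: ΓL)) N A →
        ∃ (N' : Nrm) (S' : Srt) (A' : Ty),
          HSubstS N₀ ΓR.length A₀.simple S S' ∧
          HSubstA N₀ ΓR.length A₀.simple A A' ∧
          Refines Sg (ΓR' ++ ΓL) S' A' ∧
          LFTyWf (Sig.erase Sg) (Ctx.erase (ΓR' ++ ΓL)) A' ∧
          HSubstN N₀ ΓR.length A₀.simple N N' ∧
          Check Sg (ΓR' ++ ΓL) N' S' ∧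
          LFCheck (Sig.erase Sg) (Ctx.erase (ΓR' ++ ΓL)) N' A') ∧
      -- atomic terms
      (∀ (R : Atm) (S : Srt) (A : Ty),
        Synth Sg (ΓR ++ (S₀, A₀) :: ΓL) R S →
        LFSynth (Sig.erase Sg) (Ctx.erase (ΓR ++ (S₀, A₀) :: ΓL)) R A →
        ∃ (S' : Srt) (A' : Ty),
          HSubstS N₀ ΓR.length A₀.simple S S' ∧
          HSubstA N₀ ΓR.length A₀.simple A A' ∧
          ((∃ R' : Atm, HSubstRR N₀ ΓR.length A₀.simple R R' ∧
              Synth Sg (ΓR' ++ ΓL) R' S' ∧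
              LFSynth (Sig.erase Sg) (Ctx.erase (ΓR' ++ ΓL)) R' A') ∨
            (∃ N' : Nrm, HSubstRN N₀ ΓR.length A₀.simple R N' A'.simple ∧
              Check Sg (ΓR' ++ ΓL) N' S' ∧
              LFCheck (Sig.erase Sg) (Ctx.erase (ΓR' ++ ΓL)) N' A'))) ∧
      -- sorts and types
      (∀ (S : Srt) (A : Ty),
        Refines Sg (ΓR ++ (S₀, A₀) :: ΓL) S A →
        LFTyWf (Sig.erase Sg) (Ctx.erase (ΓR ++ (S₀, A₀) :: ΓL)) A →
        ∃ (S' : Srt) (A' : Ty),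
          HSubstS N₀ ΓR.length A₀.simple S S' ∧
          HSubstA N₀ ΓR.length A₀.simple A A' ∧
          Refines Sg (ΓR' ++ ΓL) S' A' ∧
          LFTyWf (Sig.erase Sg) (Ctx.erase (ΓR' ++ ΓL)) A') ∧
      -- atomic sort families and atomic type families
      (∀ (Q : ASrt) (P : ATy) (L : Cls) (K : Kind),
        SynthCls Sg (ΓR ++ (S₀, A₀) :: ΓL) Q P L →
        LFSynthKind (Sig.erase Sg) (Ctx.erase (ΓR ++ (S₀, A₀) :: ΓL)) P K →
        ∃ (Q' : ASrt) (P' : ATy) (L' : Cls) (K' : Kind),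
          HSubstQ N₀ ΓR.length A₀.simple Q Q' ∧
          HSubstP N₀ ΓR.length A₀.simple P P' ∧
          HSubstL N₀ ΓR.length A₀.simple L L' ∧
          HSubstK N₀ ΓR.length A₀.simple K K' ∧
          SynthCls Sg (ΓR' ++ ΓL) Q' P' L' ∧
          LFSynthKind (Sig.erase Sg) (Ctx.erase (ΓR' ++ ΓL)) P' K') ∧
      -- classes and kinds
      (∀ (L : Cls) (K : Kind),
        RefinesCls Sg (ΓR ++ (S₀, A₀) :: ΓL) L K →
        LFKindWf (Sig.erase Sg) (Ctx.erase (ΓR ++ (S₀, A₀) :: ΓL)) K →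
        ∃ (L' : Cls) (K' : Kind),
          HSubstL N₀ ΓR.length A₀.simple L L' ∧
          HSubstK N₀ ΓR.length A₀.simple K K' ∧
          RefinesCls Sg (ΓR' ++ ΓL) L' K' ∧
          LFKindWf (Sig.erase Sg) (Ctx.erase (ΓR' ++ ΓL)) K') :=
  mainTheorem2_general Sg hSg.closed ΓL ΓR N₀ S₀ A₀ hN₀ hN₀' hΓ hΓ'
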